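/- Let $\mathcal L_k\subset\mathbb R^{2n}=\{(P,Q)\}$ be a $k$-dimensional subspace which is isotropic for the symplectic form $\omega((P,Q),(P',Q'))=\sum_j (P_jQ'_j-P'_jQ_j)$, and let $d\mu$ be a (nonzero) translation-invariant Lebesgue measure on $\mathcal L_k$. For $Y=(P,Q)\in\mathbb C^{2n}$ let $\Omega(Y)=\sum_j\bigl(P_j\xi_j-Q_j\tfrac1i\tfrac{\partial}{\partial \xi_j}\bigr)$, acting on the Schwartz space $\mathcal S(\mathbb R^n)$ of complex-valued functions, and for real $Y=(P,Q)$ let $e^{i\Omega(Y)}$ be the operator $(e^{i\Omega(Y)}\psi)(\xi)=e^{i\sum_j P_j\xi_j-\frac i2\sum_j P_jQ_j}\,\psi(\xi-Q)$. Equip $\mathcal S(\mathbb R^n)$ with the positive semidefinite inner product $$\langle\psi,\varphi\rangle=\int_{\mathcal L_k}d\mu(X)\,(\psi,e^{i\Omega(X)}\varphi),\qquad (\psi,\varphi)=\int_{\mathbb R^n}\overline{\psi(\xi)}\,\varphi(\xi)\,d\xi ,$$ write $\psi\sim\varphi$ if $\langle\psi-\varphi,\psi-\varphi\rangle=0$,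 let $[\psi]$ be the class of $\psi$, and let the physical Hilbert space $\mathcal H$ be the completion of $\mathcal S(\mathbb R^n)/\!\sim$. Let $\mathcal L_k^{\perp\omega}\subset\mathbb R^{2n}$ be the skew-orthogonal complement of $\mathcal L_k$, and $(\mathcal L_k^{\mathbb C})^{\perp\omega}\subset\mathbb C^{2n}$ that of its complexification (with respect to the complex-bilinear extension of $\omega$). For $Y\in\mathcal L_k^{\perp\omega}$ the operator $e^{i\Omega(Y)}$ descends to $\mathcal S(\mathbb R^n)/\!\sim$ and extends by continuity to $\mathcal H$; for $Y\in(\mathcal L_k^{\mathbb C})^{\perp\omega}$ the operator $\Omega(Y)$ descends to $\mathcal S(\mathbb R^n)/\!\sim$. Let $\psi_A(\xi)=c\,\exp\bigl(\tfrac i2\sum_{j,l}\xi_jA_{jl}\xi_l\bigr)$ be a Gaussian function, where $c\in\mathbb C\setminus\{0\}$ and $A$ is a complex symmetric $n\times n$ matrix with positive definite imaginary part. Let $$\check r(A)=\{Y\in(\mathcal L_k^{\mathbb C})^{\perp\omega}\;:\;\|\Omega(Y)[\psi_A]\|=0\},\qquad \check r^*(A)=\{Y^*\;:\;Y\in\check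 r(A)\},$$ where $Y^*$ is the componentwise complex conjugate of $Y$. Then: 1. The set of all finite linear combinations of the vectors $e^{i\Omega(Y)}[\psi_A]$, $Y\in\mathcal L_k^{\perp\omega}$, is dense in $\mathcal H$. 2. The set of all finite linear combinations of the vectors $\Omega(Y_1^*)\cdots\Omega(Y_p^*)[\psi_A]$, $p\ge 0$, $Y_1^*,\dots,Y_p^*\in\check r^*(A)$, is dense in $\mathcal H$. -/

import Mathlib

open MeasureTheory Filter Topology
open scoped SchwartzMap LineDeriv ComplexConjugate

noncomputable section

namespace LinearConstraint

/-- The phase space `R^{2n}` of pairs `(P, Q)`, `R = ℝ` or `R = ℂ`. -/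
abbrev Phase (R : Type) (n : ℕ) : Type := (Fin n → R) × (Fin n → R)

/-- The Schwartz space `𝓢(ℝⁿ)` of complex wave functions. -/
abbrev Wave (n : ℕ) : Type := 𝓢(EuclideanSpace ℝ (Fin n), ℂ)

/-- The symplectic form `ω((P,Q),(P',Q')) = ∑ j, (P_j Q'_j - P'_j Q_j)` (bilinear also for `R = ℂ`). -/
def sympl {R : Type} [CommRing R] {n : ℕ} (X X' : Phase R n) : R :=
  ∑ j, (X.1 j * X'.2 j - X'.1 j * X.2 j)

/-- The inclusion `ℝ^{2n} ⊂ ℂ^{2n}`. -/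
def toComplex {n : ℕ} (X : Phase ℝ n) : Phase ℂ n :=
  (fun j => (X.1 j : ℂ), fun j => (X.2 j : ℂ))

/-- Multiplication by the coordinate `ξ_j`. -/
def coordOp {n : ℕ} (j : Fin n) : Wave n →L[ℂ] Wave n :=
  SchwartzMap.smulLeftCLM ℂ (fun ξ : EuclideanSpace ℝ (Fin n) => ((ξ j : ℝ) : ℂ))

/-- The partial derivative `∂/∂ξ_j`. -/
def partialOp {n : ℕ} (j : Fin n) : Wave n →L[ℂ] Wave n :=
  LineDeriv.lineDerivOpCLM ℂ (Wave n) (EuclideanSpace.single j (1 : ℝ))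

/-- `Ω(P,Q) = ∑ j, (P_j ξ_j - Q_j (1/i) ∂/∂ξ_j)`, for complex `(P,Q)`. -/
def Omega {n : ℕ} (Y : Phase ℂ n) : Wave n →L[ℂ] Wave n :=
  ∑ j, (Y.1 j • coordOp j - Y.2 j • ((1 / Complex.I) • partialOp j))

/-- The phase factor `exp (i (∑ P_j ξ_j - (1/2) ∑ P_j Q_j))`. -/
def weylPhase {n : ℕ} (X : Phase ℝ n) (ξ : EuclideanSpace ℝ (Fin n)) : ℂ :=
  Complex.exp (Complex.I * ((∑ j, X.1 j * ξ j - (1 / 2) * ∑ j, X.1 j * X.2 j : ℝ) : ℂ))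

/-- The operator `e^{iΩ(X)}`, `X = (P,Q)` real, on Schwartz functions:
`(e^{iΩ(X)} ψ)(ξ) = exp (i (∑ P_j ξ_j - (1/2) ∑ P_j Q_j)) ψ(ξ - Q)`. -/
def weyl {n : ℕ} (X : Phase ℝ n) : Wave n →L[ℂ] Wave n :=
  (SchwartzMap.smulLeftCLM ℂ (weylPhase X)).comp
    (SchwartzMap.compSubConstCLM ℂ (WithLp.toLp 2 X.2))

/-- The inner product `(ψ, φ)` of `L²(ℝⁿ)`, antilinear in the first argument. -/
def l2 {n : ℕ} (ψ φ : Wave n) : ℂ := ∫ ξ, conj (ψ ξ) * φ ξ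

section Basic

variable {n : ℕ}

theorem hasTemperateGrowth_coord (j : Fin n) :
    Function.HasTemperateGrowth (fun ξ : EuclideanSpace ℝ (Fin n) => ((ξ j : ℝ) : ℂ)) :=
  (Complex.ofRealCLM.comp (EuclideanSpace.proj (𝕜 := ℝ) j)).hasTemperateGrowth

theorem hasTemperateGrowth_cexp_I :
    Function.HasTemperateGrowth (fun t : ℝ => Complex.exp (Complex.I * (t : ℂ))) := by
  have h : ∀ m : ℕ, iteratedDeriv m (fun t : ℝ => Complex.exp (Complex.I * (t : ℂ)))
      = fun t : ℝ => Complex.I ^ m * Complex.exp (Complex.I * (t : ℂ)) := by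
    intro m
    induction m with
    | zero => simp
    | succ m ih =>
      rw [iteratedDeriv_succ, ih]
      funext t
      have : HasDerivAt (fun t : ℝ => Complex.exp (Complex.I * (t : ℂ)))
          (Complex.exp (Complex.I * (t : ℂ)) * (Complex.I * 1)) t :=
        (((Complex.ofRealCLM.hasDerivAt (x := t)).const_mul Complex.I)).cexp
      rw [(this.const_mul _).deriv]
      ring
  refine ⟨Complex.contDiff_exp.comp (contDiff_const.mul Complex.ofRealCLM.contDiff), fun m => ⟨0, 1, fun t => ?_⟩⟩
  rw [norm_iteratedFDeriv_eq_norm_iteratedDeriv, h m]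
  simp [mul_comm Complex.I, Complex.norm_exp_ofReal_mul_I]

theorem hasTemperateGrowth_weylPhase (X : Phase ℝ n) :
    Function.HasTemperateGrowth (weylPhase X) := by
  have h1 : Function.HasTemperateGrowth (fun ξ : EuclideanSpace ℝ (Fin n) =>
      ∑ j, X.1 j * ξ j - (1 / 2) * ∑ j, X.1 j * X.2 j) := by
    refine Function.HasTemperateGrowth.sub ?_ (Function.HasTemperateGrowth.const _)
    refine Function.HasTemperateGrowth.sum (fun j _ => ?_)
    exact (Function.HasTemperateGrowth.const _).mul
      (EuclideanSpace.proj (𝕜 := ℝ) j).hasTemperateGrowth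
  exact hasTemperateGrowth_cexp_I.comp h1

theorem coordOp_apply (j : Fin n) (ψ : Wave n) (ξ) : coordOp j ψ ξ = (ξ j : ℂ) * ψ ξ := by
  rw [coordOp, SchwartzMap.smulLeftCLM_apply_apply (hasTemperateGrowth_coord j)]; rfl

theorem partialOp_apply (j : Fin n) (ψ : Wave n) (ξ) :
    partialOp j ψ ξ = fderiv ℝ ψ ξ (EuclideanSpace.single j (1 : ℝ)) := by
  rw [partialOp, LineDeriv.lineDerivOpCLM_apply, SchwartzMap.lineDerivOp_apply_eq_fderiv]

theorem Omega_apply (Y : Phase ℂ n) (ψ : Wave n) (ξ) :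
    Omega Y ψ ξ = ∑ j, (Y.1 j * (ξ j * ψ ξ) + Complex.I * (Y.2 j *
      fderiv ℝ ψ ξ (EuclideanSpace.single j (1 : ℝ)))) := by
  have : Omega Y ψ ξ = ∑ j, (Y.1 j • coordOp j - Y.2 j • ((1 / Complex.I) • partialOp j)) ψ ξ := by
    simp [Omega]
  rw [this]
  refine Finset.sum_congr rfl fun j _ => ?_
  simp [coordOp_apply, partialOp_apply]
  ring

theorem weyl_apply (X : Phase ℝ n) (ψ : Wave n) (ξ) :
    weyl X ψ ξ = weylPhase X ξ * ψ (ξ - WithLp.toLp 2 X.2) := by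
  simp [weyl, SchwartzMap.smulLeftCLM_apply_apply (hasTemperateGrowth_weylPhase X)]

theorem norm_weylPhase (X : Phase ℝ n) (ξ) : ‖weylPhase X ξ‖ = 1 := by
  rw [weylPhase, mul_comm, Complex.norm_exp_ofReal_mul_I]

theorem conj_weylPhase_mul (X : Phase ℝ n) (ξ) : conj (weylPhase X ξ) * weylPhase X ξ = 1 := by
  rw [← Complex.normSq_eq_conj_mul_self, Complex.normSq_eq_norm_sq, norm_weylPhase]; simp

/-- The Weyl relations. -/
theorem weyl_weyl (X X' : Phase ℝ n) (ψ : Wave n) :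
    weyl X (weyl X' ψ) = Complex.exp (Complex.I / 2 * (sympl X X' : ℝ)) • weyl (X + X') ψ := by
  ext ξ
  simp only [weyl_apply, smul_apply, smul_eq_mul]
  have h1 : ξ - WithLp.toLp 2 X.2 - WithLp.toLp 2 X'.2
      = ξ - WithLp.toLp 2 (X + X').2 := by
    simp [sub_sub]
  rw [h1, ← mul_assoc, ← mul_assoc]
  congr 1
  simp only [weylPhase, ← Complex.exp_add]
  congr 1
  have h2 : (∑ j, X.1 j * ξ j - (1 / 2) * ∑ j, X.1 j * X.2 j)
      + (∑ j, X'.1 j * (ξ - WithLp.toLp 2 X.2 : EuclideanSpace ℝ (Fin n)) j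
        - (1 / 2) * ∑ j, X'.1 j * X'.2 j)
      = (1 / 2) * sympl X X' + (∑ j, (X + X').1 j * ξ j
        - (1 / 2) * ∑ j, (X + X').1 j * (X + X').2 j) := by
    simp only [sympl, Finset.mul_sum, ← Finset.sum_sub_distrib, ← Finset.sum_add_distrib]
    refine Finset.sum_congr rfl fun j _ => ?_
    simp
    ring
  rw [← mul_add, ← Complex.ofReal_add, h2]
  push_cast
  ring

theorem weyl_zero (ψ : Wave n) : weyl (0 : Phase ℝ n) ψ = ψ := by
  ext ξ
  simp [weyl_apply, weylPhase]

theorem sympl_self (X : Phase ℝ n) : sympl X X = 0 := by simp [sympl]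

theorem sympl_neg_right (X X' : Phase ℝ n) : sympl X (-X') = - sympl X X' := by
  simp only [sympl, ← Finset.sum_neg_distrib]
  exact Finset.sum_congr rfl fun j _ => by simp; ring

theorem sympl_comm (X X' : Phase ℝ n) : sympl X X' = - sympl X' X := by
  simp only [sympl, ← Finset.sum_neg_distrib]
  exact Finset.sum_congr rfl fun j _ => by ring

theorem sympl_toComplex (X X' : Phase ℝ n) :
    sympl (toComplex X) (toComplex X') = (sympl X X' : ℝ) := by
  simp [sympl, toComplex]

theorem l2_integrable (ψ φ : Wave n) : Integrable (fun ξ => conj (ψ ξ) * φ ξ) := by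
  refine (φ.integrable (μ := volume)).bdd_mul (c := SchwartzMap.seminorm ℝ 0 0 ψ)
    (Complex.continuous_conj.comp ψ.continuous).aestronglyMeasurable
    (Eventually.of_forall fun ξ => ?_)
  simpa using SchwartzMap.norm_le_seminorm ℝ ψ ξ

theorem l2_add_left (ψ ψ' φ : Wave n) : l2 (ψ + ψ') φ = l2 ψ φ + l2 ψ' φ := by
  rw [l2, l2, l2, ← integral_add (l2_integrable _ _) (l2_integrable _ _)]
  congr 1; ext ξ; simp; ring

theorem l2_smul_left (c : ℂ) (ψ φ : Wave n) : l2 (c • ψ) φ = conj c * l2 ψ φ := by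
  rw [l2, l2, ← integral_const_mul]
  congr 1; ext ξ; simp; ring

theorem l2_conj (ψ φ : Wave n) : conj (l2 ψ φ) = l2 φ ψ := by
  rw [l2, l2, ← integral_conj]
  congr 1; ext ξ; simp; ring

theorem l2_add_right (ψ φ φ' : Wave n) : l2 ψ (φ + φ') = l2 ψ φ + l2 ψ φ' := by
  rw [← l2_conj, l2_add_left, map_add, l2_conj, l2_conj]

theorem l2_smul_right (c : ℂ) (ψ φ : Wave n) : l2 ψ (c • φ) = c * l2 ψ φ := by
  rw [← l2_conj, l2_smul_left, map_mul, l2_conj, Complex.conj_conj]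

theorem l2_sum_left {ι : Type} (s : Finset ι) (f : ι → Wave n) (φ : Wave n) :
    l2 (∑ i ∈ s, f i) φ = ∑ i ∈ s, l2 (f i) φ := by
  classical
  induction s using Finset.induction_on with
  | empty => simp [l2]
  | insert a s ha ih => rw [Finset.sum_insert ha, Finset.sum_insert ha, l2_add_left, ih]

theorem l2_sum_right {ι : Type} (s : Finset ι) (f : ι → Wave n) (φ : Wave n) :
    l2 φ (∑ i ∈ s, f i) = ∑ i ∈ s, l2 φ (f i) := by
  rw [← l2_conj, l2_sum_left, map_sum]
  exact Finset.sum_congr rfl fun i _ => l2_conj _ _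

theorem l2_weyl_weyl (X : Phase ℝ n) (ψ φ : Wave n) : l2 (weyl X ψ) (weyl X φ) = l2 ψ φ := by
  rw [l2, l2, ← integral_sub_right_eq_self (fun ξ => conj (ψ ξ) * φ ξ) (WithLp.toLp 2 X.2)]
  congr 1; ext ξ
  rw [weyl_apply, weyl_apply, map_mul]
  linear_combination (conj (ψ (ξ - WithLp.toLp 2 X.2)) * φ (ξ - WithLp.toLp 2 X.2)) *
    conj_weylPhase_mul X ξ

theorem weyl_neg_weyl (X : Phase ℝ n) (ψ : Wave n) : weyl (-X) (weyl X ψ) = ψ := by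
  rw [weyl_weyl, sympl_comm, sympl_neg_right, sympl_self]; simp [weyl_zero]

theorem l2_weyl_right (X : Phase ℝ n) (ψ φ : Wave n) : l2 ψ (weyl X φ) = l2 (weyl (-X) ψ) φ := by
  rw [← l2_weyl_weyl (-X), weyl_neg_weyl]

theorem l2_partial (j : Fin n) (ψ φ : Wave n) :
    l2 ψ (partialOp j φ) = - l2 (partialOp j ψ) φ := by
  have h := SchwartzMap.integral_bilinear_lineDerivOp_right_eq_neg_left (μ := volume) ψ φ
    ((ContinuousLinearMap.mul ℝ ℂ).comp (Complex.conjCLE : ℂ →L[ℝ] ℂ))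
    (EuclideanSpace.single j (1 : ℝ))
  exact h

theorem l2_coord (j : Fin n) (ψ φ : Wave n) : l2 ψ (coordOp j φ) = l2 (coordOp j ψ) φ := by
  rw [l2, l2]
  congr 1; ext ξ; simp [coordOp_apply]; ring

theorem Omega_eq (Y : Phase ℂ n) (ψ : Wave n) :
    Omega Y ψ = ∑ j, (Y.1 j • coordOp j ψ + (Complex.I * Y.2 j) • partialOp j ψ) := by
  rw [Omega, sum_apply]
  refine Finset.sum_congr rfl fun j _ => ?_
  rw [sub_apply, smul_apply,
    smul_apply, smul_apply, smul_smul, sub_eq_add_neg,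
    ← neg_smul]
  congr 2
  simp; ring

theorem l2_Omega_right (Y : Phase ℂ n) (ψ φ : Wave n) :
    l2 ψ (Omega Y φ) = l2 (Omega (star Y) ψ) φ := by
  rw [Omega_eq, Omega_eq, l2_sum_right, l2_sum_left]
  refine Finset.sum_congr rfl fun j _ => ?_
  rw [l2_add_right, l2_add_left, l2_smul_right, l2_smul_right, l2_smul_left, l2_smul_left,
    l2_coord, l2_partial]
  simp

theorem hasFDerivAt_weylPhase (X : Phase ℝ n) (ξ v : EuclideanSpace ℝ (Fin n)) :
    DifferentiableAt ℝ (weylPhase X) ξ ∧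
    fderiv ℝ (weylPhase X) ξ v = weylPhase X ξ * (Complex.I * ((∑ j, X.1 j * v j : ℝ) : ℂ)) := by
  have h1 : HasFDerivAt (fun ξ : EuclideanSpace ℝ (Fin n) =>
      (∑ j, X.1 j * ξ j - (1 / 2) * ∑ j, X.1 j * X.2 j : ℝ))
      (∑ j, X.1 j • (EuclideanSpace.proj (𝕜 := ℝ) j : EuclideanSpace ℝ (Fin n) →L[ℝ] ℝ)) ξ := by
    refine HasFDerivAt.sub_const _ ?_
    refine HasFDerivAt.fun_sum fun j _ => ?_
    exact (EuclideanSpace.proj (𝕜 := ℝ) j :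
      EuclideanSpace ℝ (Fin n) →L[ℝ] ℝ).hasFDerivAt.const_mul (X.1 j)
  have h2 := ((Complex.ofRealCLM.hasFDerivAt.comp ξ h1).const_mul Complex.I).cexp
  refine ⟨h2.differentiableAt, ?_⟩
  have h3 : fderiv ℝ (weylPhase X) ξ = _ := h2.fderiv
  rw [h3]
  simp [weylPhase]

theorem Omega_weyl (Y : Phase ℂ n) (X : Phase ℝ n) (ψ : Wave n) :
    Omega Y (weyl X ψ) = weyl X (Omega Y ψ) + sympl Y (toComplex X) • weyl X ψ := by
  ext ξ
  rw [add_apply, smul_apply, weyl_apply, Omega_apply, Omega_apply,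
    weyl_apply]
  have hd : ∀ v, fderiv ℝ (weyl X ψ) ξ v
      = weylPhase X ξ * fderiv ℝ ψ (ξ - WithLp.toLp 2 X.2) v
        + weylPhase X ξ * (Complex.I * ((∑ j, X.1 j * v j : ℝ) : ℂ))
          * ψ (ξ - WithLp.toLp 2 X.2) := by
    intro v
    have e : (weyl X ψ : EuclideanSpace ℝ (Fin n) → ℂ)
        = fun ξ => weylPhase X ξ * ψ (ξ - WithLp.toLp 2 X.2) := funext (weyl_apply X ψ)
    have hψ : HasFDerivAt (fun ξ => ψ (ξ - WithLp.toLp 2 X.2))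
        (fderiv ℝ ψ (ξ - WithLp.toLp 2 X.2)) ξ := by
      have := (ψ.hasFDerivAt (ξ - WithLp.toLp 2 X.2)).comp ξ
        ((hasFDerivAt_id ξ).sub_const (WithLp.toLp 2 X.2))
      simpa [Function.comp_def] using this
    rw [e, ((hasFDerivAt_weylPhase X ξ v).1.hasFDerivAt.fun_mul hψ).fderiv]
    simp [(hasFDerivAt_weylPhase X ξ v).2]
    ring
  simp only [hd, sympl, toComplex, Finset.mul_sum, smul_eq_mul, Finset.sum_mul]
  rw [← Finset.sum_add_distrib]
  refine Finset.sum_congr rfl fun j _ => ?_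
  simp [PiLp.single_apply]
  linear_combination (weylPhase X ξ * ψ (ξ - WithLp.toLp 2 X.2) * Y.2 j * X.1 j) * Complex.I_mul_I

/-- `e^{itΩ(X)} ψ` is the solution of `du/dt = iΩ(X)u`, `u(0) = ψ`. -/
theorem hasDerivAt_weyl (X : Phase ℝ n) (ψ : Wave n) (ξ : EuclideanSpace ℝ (Fin n)) (t : ℝ) :
    HasDerivAt (fun s : ℝ => weyl (s • X) ψ ξ)
      (Complex.I * Omega (toComplex X) (weyl (t • X) ψ) ξ) t := by
  set q : EuclideanSpace ℝ (Fin n) := WithLp.toLp 2 X.2 with hq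
  set a : ℝ := ∑ j, X.1 j * ξ j with ha
  set b : ℝ := ∑ j, X.1 j * X.2 j with hb
  have e1 : (fun s : ℝ => weyl (s • X) ψ ξ) = fun s : ℝ =>
      Complex.exp (Complex.I * ((s * a - (1 / 2) * (s * s * b) : ℝ) : ℂ)) * ψ (ξ - s • q) := by
    funext s
    rw [weyl_apply, weylPhase, ha, hb]
    congr 4
    simp only [Prod.smul_fst, Prod.smul_snd, Pi.smul_apply, smul_eq_mul, Finset.mul_sum]
    congr 1 <;> exact Finset.sum_congr rfl fun j _ => by ring
  have h1 : HasDerivAt (fun s : ℝ => s * a - (1 / 2) * (s * s * b)) (a - t * b) t := by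
    have := ((hasDerivAt_id t).mul_const a).sub
      ((((hasDerivAt_id t).mul (hasDerivAt_id t)).mul_const b).const_mul (1 / 2))
    refine this.congr_deriv ?_
    simp; ring
  have h2 := ((h1.ofReal_comp).const_mul Complex.I).cexp
  have h3 : HasDerivAt (fun s : ℝ => ψ (ξ - s • q)) (fderiv ℝ ψ (ξ - t • q) (-q)) t := by
    have hl : HasDerivAt (fun s : ℝ => ξ - s • q) (-q) t := by
      simpa using ((hasDerivAt_id t).smul_const q).const_sub ξ
    exact (ψ.hasFDerivAt (ξ - t • q)).comp_hasDerivAt t hl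
  rw [e1]
  refine (h2.mul h3).congr_deriv ?_
  have e2 : sympl (toComplex X) (toComplex (t • X)) = 0 := by
    rw [sympl_toComplex]
    norm_cast
    exact Finset.sum_eq_zero fun j _ => by simp; ring
  have e3 : weyl (t • X) (Omega (toComplex X) ψ) ξ
      = Complex.exp (Complex.I * ((t * a - (1 / 2) * (t * t * b) : ℝ) : ℂ))
        * Omega (toComplex X) ψ (ξ - t • q) := by
    rw [weyl_apply, weylPhase, ha, hb]
    congr 4
    simp only [Prod.smul_fst, Prod.smul_snd, Pi.smul_apply, smul_eq_mul, Finset.mul_sum]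
    congr 1 <;> exact Finset.sum_congr rfl fun j _ => by ring
  have e4 : q = ∑ j, X.2 j • EuclideanSpace.single j (1 : ℝ) := by
    ext i
    simp [hq, Pi.single_apply]
  have e5 : Omega (toComplex X) ψ (ξ - t • q)
      = ((a - t * b : ℝ) : ℂ) * ψ (ξ - t • q) + Complex.I * fderiv ℝ ψ (ξ - t • q) q := by
    rw [Omega_apply, Finset.sum_add_distrib]
    congr 1
    · rw [ha, hb, Finset.mul_sum, ← Finset.sum_sub_distrib]
      push_cast
      rw [Finset.sum_mul]
      refine Finset.sum_congr rfl fun j _ => ?_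
      simp [toComplex, hq]
      ring
    · conv_rhs => rw [e4]
      rw [map_sum, Finset.mul_sum]
      refine Finset.sum_congr rfl fun j _ => ?_
      rw [← e4]
      simp [toComplex]
  rw [Omega_weyl, e2, zero_smul, add_zero, e3, e5, map_neg]
  linear_combination (-(Complex.exp (Complex.I * ((t * a - (1 / 2) * (t * t * b) : ℝ) : ℂ))
    * fderiv ℝ ψ (ξ - t • q) q)) * Complex.I_mul_I

end Basic

section Estimates

variable {n : ℕ}

theorem norm_l2_weyl_le (ψ φ : Wave n) :
    ∃ C, ∀ X : Phase ℝ n, ‖l2 ψ (weyl X φ)‖ ≤ C := by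
  refine ⟨∫ ξ, ‖ψ ξ‖ * SchwartzMap.seminorm ℝ 0 0 φ, fun X => ?_⟩
  refine norm_integral_le_of_norm_le (ψ.integrable.norm.mul_const _)
    (Eventually.of_forall fun ξ => ?_)
  rw [weyl_apply, norm_mul, norm_mul, norm_weylPhase, one_mul, RCLike.norm_conj]
  exact mul_le_mul_of_nonneg_left (SchwartzMap.norm_le_seminorm ℝ φ _) (norm_nonneg _)

theorem continuous_l2_weyl (ψ φ : Wave n) :
    Continuous (fun X : Phase ℝ n => l2 ψ (weyl X φ)) := by
  refine continuous_of_dominated (bound := fun ξ => ‖ψ ξ‖ * SchwartzMap.seminorm ℝ 0 0 φ)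
    (fun X => (l2_integrable ψ (weyl X φ)).aestronglyMeasurable)
    (fun X => Eventually.of_forall fun ξ => ?_) (ψ.integrable.norm.mul_const _)
    (Eventually.of_forall fun ξ => ?_)
  · rw [weyl_apply, norm_mul, norm_mul, norm_weylPhase, one_mul, RCLike.norm_conj]
    exact mul_le_mul_of_nonneg_left (SchwartzMap.norm_le_seminorm ℝ φ _) (norm_nonneg _)
  · simp only [weyl_apply, weylPhase]
    have h1 := φ.continuous
    have h2 : Continuous (fun X : Phase ℝ n => φ (ξ - WithLp.toLp 2 X.2)) :=
      h1.comp (continuous_const.sub ((PiLp.continuous_toLp 2 _).comp continuous_snd))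
    fun_prop

theorem sympl_mul_l2 (Y : Phase ℂ n) (X : Phase ℝ n) (ψ φ : Wave n) :
    sympl Y (toComplex X) * l2 ψ (weyl X φ)
      = l2 (Omega (star Y) ψ) (weyl X φ) - l2 ψ (weyl X (Omega Y φ)) := by
  rw [← l2_Omega_right, Omega_weyl, l2_add_right, l2_smul_right]
  ring

theorem norm_le_sum (X : Phase ℝ n) : ‖X‖ ≤ ∑ j, (|X.1 j| + |X.2 j|) := by
  have h : ∀ i, |X.1 i| + |X.2 i| ≤ ∑ j, (|X.1 j| + |X.2 j|) := fun i =>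
    Finset.single_le_sum (f := fun j => |X.1 j| + |X.2 j|) (fun j _ => by positivity)
      (Finset.mem_univ i)
  have h0 : 0 ≤ ∑ j, (|X.1 j| + |X.2 j|) := Finset.sum_nonneg fun j _ => by positivity
  refine max_le ((pi_norm_le_iff_of_nonneg h0).2 fun i => ?_)
    ((pi_norm_le_iff_of_nonneg h0).2 fun i => ?_)
  · rw [Real.norm_eq_abs]; linarith [h i, abs_nonneg (X.2 i)]
  · rw [Real.norm_eq_abs]; linarith [h i, abs_nonneg (X.1 i)]

theorem decay_l2_weyl (m : ℕ) : ∀ ψ φ : Wave n,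
    ∃ C, ∀ X : Phase ℝ n, ‖X‖ ^ m * ‖l2 ψ (weyl X φ)‖ ≤ C := by
  induction m with
  | zero => simpa using norm_l2_weyl_le
  | succ m ih =>
    intro ψ φ
    have key : ∀ Y : Phase ℂ n, ∃ C, ∀ X : Phase ℝ n,
        ‖sympl Y (toComplex X)‖ * (‖X‖ ^ m * ‖l2 ψ (weyl X φ)‖) ≤ C := by
      intro Y
      obtain ⟨C1, h1⟩ := ih (Omega (star Y) ψ) φ
      obtain ⟨C2, h2⟩ := ih ψ (Omega Y φ)
      refine ⟨C1 + C2, fun X => ?_⟩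
      calc _ = ‖X‖ ^ m * ‖sympl Y (toComplex X) * l2 ψ (weyl X φ)‖ := by rw [norm_mul]; ring
        _ ≤ ‖X‖ ^ m * (‖l2 (Omega (star Y) ψ) (weyl X φ)‖ + ‖l2 ψ (weyl X (Omega Y φ))‖) := by
          rw [sympl_mul_l2]
          exact mul_le_mul_of_nonneg_left (norm_sub_le _ _) (by positivity)
        _ ≤ C1 + C2 := by rw [mul_add]; exact add_le_add (h1 X) (h2 X)
    choose K hK using key
    refine ⟨∑ j, (K (0, Pi.single j 1) + K (Pi.single j 1, 0)), fun X => ?_⟩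
    calc ‖X‖ ^ (m + 1) * ‖l2 ψ (weyl X φ)‖
        = ‖X‖ * (‖X‖ ^ m * ‖l2 ψ (weyl X φ)‖) := by ring
      _ ≤ (∑ j, (|X.1 j| + |X.2 j|)) * (‖X‖ ^ m * ‖l2 ψ (weyl X φ)‖) :=
        mul_le_mul_of_nonneg_right (norm_le_sum X) (by positivity)
      _ ≤ _ := by
        rw [Finset.sum_mul]
        refine Finset.sum_le_sum fun j _ => ?_
        rw [add_mul]
        refine add_le_add ?_ ?_
        · refine le_trans (le_of_eq ?_) (hK (0, Pi.single j 1) X)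
          congr 1
          simp [sympl, toComplex, Pi.single_apply]
        · refine le_trans (le_of_eq ?_) (hK (Pi.single j 1, 0) X)
          congr 1
          simp [sympl, toComplex, Pi.single_apply]

theorem integrable_exp_neg_norm_sq {V : Type*} [NormedAddCommGroup V] [NormedSpace ℝ V]
    [FiniteDimensional ℝ V] [MeasurableSpace V] [BorelSpace V] (μ : Measure V)
    [μ.IsAddHaarMeasure] {t : ℝ} (ht : 0 < t) :
    Integrable (fun x : V => Real.exp (-t * ‖toEuclidean x‖ ^ 2)) μ := by
  have h1 : Integrable (fun y : EuclideanSpace ℝ (Fin (Module.finrank ℝ V)) =>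
      Real.exp (-t * ‖y‖ ^ 2)) volume := by
    have := (GaussianFourier.integrable_cexp_neg_mul_sq_norm_add (b := (t : ℂ)) (by simpa using ht)
      0 (0 : EuclideanSpace ℝ (Fin (Module.finrank ℝ V)))).norm
    refine this.congr (Eventually.of_forall fun y => ?_)
    simp only [Complex.norm_exp]
    congr 1
    simp [← Complex.ofReal_pow]
  have : (μ.map (toEuclidean (E := V))).IsAddHaarMeasure :=
    ContinuousLinearEquiv.isAddHaarMeasure_map toEuclidean μ
  have h2 : Integrable (fun y : EuclideanSpace ℝ (Fin (Module.finrank ℝ V)) =>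
      Real.exp (-t * ‖y‖ ^ 2)) (μ.map (toEuclidean (E := V))) := by
    rw [Measure.isAddLeftInvariant_eq_smul (μ.map (toEuclidean (E := V))) volume]
    exact h1.smul_measure_nnreal
  exact (integrable_map_measure h2.aestronglyMeasurable
    toEuclidean.continuous.measurable.aemeasurable).1 h2

/-- The integral of an integrable positive-definite function is nonnegative. -/
theorem re_integral_nonneg {V : Type*} [NormedAddCommGroup V] [NormedSpace ℝ V]
    [FiniteDimensional ℝ V] [MeasurableSpace V] [BorelSpace V] (μ : Measure V)
    [μ.IsAddHaarMeasure] {H : Type*} [NormedAddCommGroup H] [InnerProductSpace ℂ H]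
    [CompleteSpace H] (v : V → H) (f : V → ℂ) (hfc : Continuous f) (hf : Integrable f μ)
    (hv : ∀ x y, inner ℂ (v x) (v y) = f (y - x)) : 0 ≤ (∫ x, f x ∂μ).re := by
  have hvn : ∀ x, ‖v x‖ ^ 2 = (f 0).re := fun x => by
    rw [← inner_self_eq_norm_sq (𝕜 := ℂ), hv, sub_self]; rfl
  have hvc : Continuous v := by
    rw [continuous_iff_continuousAt]
    intro x
    rw [ContinuousAt, tendsto_iff_norm_sub_tendsto_zero]
    have e : ∀ y, ‖v y - v x‖ = √(2 * (f 0).re - 2 * (f (x - y)).re) := fun y => by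
      rw [← Real.sqrt_sq (norm_nonneg _), @norm_sub_sq ℂ, hvn, hvn, hv]
      congr 1
      simp only [RCLike.re_to_complex]
      ring
    simp only [e]
    have : Tendsto (fun y => √(2 * (f 0).re - 2 * (f (x - y)).re)) (𝓝 x)
        (𝓝 (√(2 * (f 0).re - 2 * (f (x - x)).re))) := by
      refine Continuous.tendsto (f := fun y => √(2 * (f 0).re - 2 * (f (x - y)).re)) ?_ x
      fun_prop
    simpa using this
  have hvb : ∀ x, ‖v x‖ ≤ √((f 0).re) := fun x => by
    rw [← hvn x, Real.sqrt_sq (norm_nonneg _)]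
  have step : ∀ t : ℝ, 0 < t →
      0 ≤ (∫ x, f x * (Real.exp (-(t / 2) * ‖toEuclidean x‖ ^ 2) : ℂ) ∂μ).re := by
    intro t ht
    set g : V → ℝ := fun x => Real.exp (-t * ‖toEuclidean x‖ ^ 2) with hg
    have hgi : Integrable g μ := integrable_exp_neg_norm_sq μ ht
    have hgc : Continuous g := by
      have := (toEuclidean (E := V)).continuous
      fun_prop
    have hg0 : ∀ x, 0 ≤ g x := fun x => (Real.exp_pos _).le
    have hg1 : ∀ x, g x ≤ 1 := fun x => Real.exp_le_one_iff.2 (by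
      have := mul_nonneg ht.le (sq_nonneg ‖toEuclidean x‖); linarith)
    have hgv : Integrable (fun x => ((g x : ℝ) : ℂ) • v x) μ := by
      refine (hgi.mul_const (√((f 0).re))).mono'
        ((Complex.continuous_ofReal.comp hgc).smul hvc).aestronglyMeasurable
        (Eventually.of_forall fun x => ?_)
      rw [norm_smul, Complex.norm_real, Real.norm_of_nonneg (hg0 x)]
      exact mul_le_mul_of_nonneg_left (hvb x) (hg0 x)
    set c : ℝ := ∫ x, Real.exp (-(2 * t) * ‖toEuclidean x‖ ^ 2) ∂μ with hc
    have hcpos : 0 < c := integral_exp_pos (integrable_exp_neg_norm_sq μ (by positivity))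
    have hgg : ∀ x, ∫ y, g (x + y) * g y ∂μ
        = Real.exp (-(t / 2) * ‖toEuclidean x‖ ^ 2) * c := by
      intro x
      rw [hc, ← integral_add_right_eq_self
        (fun y => Real.exp (-(2 * t) * ‖toEuclidean y‖ ^ 2)) ((1 / 2 : ℝ) • x),
        ← integral_const_mul]
      congr 1
      funext y
      simp only [hg, ← Real.exp_add, map_add, map_smul]
      congr 1
      simp only [@norm_add_sq_real, norm_smul, real_inner_smul_right, real_inner_comm,
        Real.norm_eq_abs]
      rw [abs_of_pos (by norm_num : (0 : ℝ) < 1 / 2)]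
      rw [real_inner_comm]
      ring
    have hI : inner ℂ (∫ x, ((g x : ℝ) : ℂ) • v x ∂μ) (∫ x, ((g x : ℝ) : ℂ) • v x ∂μ)
        = (∫ x, f x * (Real.exp (-(t / 2) * ‖toEuclidean x‖ ^ 2) : ℂ) ∂μ) * c := by
      have h1 : ∀ y, inner ℂ (∫ x, ((g x : ℝ) : ℂ) • v x ∂μ) (((g y : ℝ) : ℂ) • v y)
          = ∫ x, ((g (x + y) : ℝ) : ℂ) * (g y : ℝ) * f (-x) ∂μ := by
        intro y
        rw [← inner_conj_symm, ← integral_inner hgv, ← integral_conj,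
          ← integral_add_right_eq_self _ y]
        congr 1
        funext x
        rw [inner_conj_symm, inner_smul_left, inner_smul_right, hv, Complex.conj_ofReal]
        rw [show y - (x + y) = -x by abel]
        ring
      rw [← integral_inner hgv]
      simp only [h1]
      have hint : Integrable (Function.uncurry
          (fun (y x : V) => ((g (x + y) : ℝ) : ℂ) * (g y : ℝ) * f (-x))) (μ.prod μ) := by
        have := hgi.mul_prod hf.comp_neg.norm
        refine this.mono' ?_ (Eventually.of_forall fun p => ?_)
        · refine Continuous.aestronglyMeasurable ?_
          simp only [Function.uncurry_def]
          fun_prop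
        · simp only [Function.uncurry_def, norm_mul, Complex.norm_real,
            Real.norm_of_nonneg (hg0 _)]
          refine mul_le_mul_of_nonneg_right ?_ (norm_nonneg _)
          exact mul_le_of_le_one_left (hg0 _) (hg1 _)
      rw [integral_integral_swap hint, ← integral_neg_eq_self, ← integral_mul_const]
      congr 1
      funext x
      rw [integral_mul_const]
      have : ∫ y, ((g (-x + y) : ℝ) : ℂ) * (g y : ℝ) ∂μ
          = ((∫ y, g (-x + y) * g y ∂μ : ℝ) : ℂ) := by
        rw [← integral_complex_ofReal]; simp
      rw [this, hgg, neg_neg, map_neg, norm_neg]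
      push_cast
      ring
    have h2 := inner_self_nonneg (𝕜 := ℂ) (x := ∫ x, ((g x : ℝ) : ℂ) • v x ∂μ)
    rw [hI, RCLike.re_to_complex, Complex.re_mul_ofReal] at h2
    exact nonneg_of_mul_nonneg_left h2 hcpos
  have hlim : Tendsto (fun m : ℕ => ∫ x, f x *
      (Real.exp (-((1 / ((m : ℝ) + 1)) / 2) * ‖toEuclidean x‖ ^ 2) : ℂ) ∂μ) atTop
      (𝓝 (∫ x, f x ∂μ)) := by
    refine tendsto_integral_of_dominated_convergence (fun x => ‖f x‖) (fun m => ?_) hf.norm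
      (fun m => Eventually.of_forall fun x => ?_) (Eventually.of_forall fun x => ?_)
    · have := (toEuclidean (E := V)).continuous
      exact Continuous.aestronglyMeasurable (by fun_prop)
    · rw [norm_mul, Complex.norm_real, Real.norm_of_nonneg (Real.exp_pos _).le]
      refine mul_le_of_le_one_right (norm_nonneg _) (Real.exp_le_one_iff.2 ?_)
      have : 0 ≤ (1 / ((m : ℝ) + 1)) / 2 * ‖toEuclidean x‖ ^ 2 := by positivity
      linarith
    · have h3 : Tendsto (fun m : ℕ => (1 / ((m : ℝ) + 1))) atTop (𝓝 0) :=
        tendsto_one_div_add_atTop_nhds_zero_nat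
      have h4 : Continuous (fun s : ℝ => f x *
        (Real.exp (-(s / 2) * ‖toEuclidean x‖ ^ 2) : ℂ)) := by fun_prop
      simpa [Function.comp_def] using (h4.tendsto 0).comp h3
  exact ge_of_tendsto' ((Complex.continuous_re.tendsto _).comp hlim)
    fun m => step _ (by positivity)

end Estimates

/-- A system of linear constraints: a `k`-dimensional isotropic plane `𝓛_k` in the phase space
`ℝ^{2n}`, together with a shift-invariant (Lebesgue) measure `μ` on it. -/
structure ConstraintPlane (n k : ℕ) where
  plane : Submodule ℝ (Phase ℝ n)
  finrank_plane : Module.finrank ℝ plane = k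
  isotropic : ∀ X ∈ plane, ∀ X' ∈ plane, sympl X X' = 0
  μ : Measure plane
  isAddHaar : μ.IsAddHaarMeasure

attribute [instance] ConstraintPlane.isAddHaar

namespace ConstraintPlane

variable {n k : ℕ} (C : ConstraintPlane n k)

/-- The form `⟨ψ, φ⟩ = ∫_{𝓛_k} (ψ, e^{iΩ(X)} φ) dμ(X)`. -/
def form (ψ φ : Wave n) : ℂ := ∫ X : C.plane, l2 ψ (weyl (X : Phase ℝ n) φ) ∂C.μ

theorem continuous_integrand (ψ φ : Wave n) :
    Continuous (fun X : C.plane => l2 ψ (weyl (X : Phase ℝ n) φ)) :=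
  (continuous_l2_weyl ψ φ).comp continuous_subtype_val

theorem integrable_integrand (ψ φ : Wave n) :
    Integrable (fun X : C.plane => l2 ψ (weyl (X : Phase ℝ n) φ)) C.μ := by
  obtain ⟨C1, h1⟩ := norm_l2_weyl_le ψ φ
  obtain ⟨C2, h2⟩ := decay_l2_weyl (0 + C.μ.integrablePower) ψ φ
  have hm := (C.continuous_integrand ψ φ).aestronglyMeasurable (μ := C.μ)
  have := integrable_of_le_of_pow_mul_le (μ := C.μ) (k := 0)
    (f := fun X : C.plane => l2 ψ (weyl (X : Phase ℝ n) φ)) (fun X => h1 X) (fun X => h2 X) hm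
  simp only [pow_zero, one_mul] at this
  exact (integrable_norm_iff hm).1 this

theorem form_add_left (ψ ψ' φ : Wave n) :
    C.form (ψ + ψ') φ = C.form ψ φ + C.form ψ' φ := by
  simp only [form, l2_add_left]
  exact integral_add (C.integrable_integrand _ _) (C.integrable_integrand _ _)

theorem form_smul_left (c : ℂ) (ψ φ : Wave n) : C.form (c • ψ) φ = conj c * C.form ψ φ := by
  simp only [form, l2_smul_left]
  exact integral_const_mul _ _

theorem form_conj (ψ φ : Wave n) : conj (C.form φ ψ) = C.form ψ φ := by
  have : ProperSpace C.plane := FiniteDimensional.proper ℝ C.plane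
  rw [form, form, ← integral_conj, ← integral_neg_eq_self]
  congr 1
  funext X
  rw [l2_conj, l2_weyl_right]
  simp

theorem form_nonneg (ψ : Wave n) : 0 ≤ (C.form ψ ψ).re := by
  refine re_integral_nonneg C.μ (fun X : C.plane => (weyl (X : Phase ℝ n) ψ).toLp 2 volume)
    (fun X : C.plane => l2 ψ (weyl (X : Phase ℝ n) ψ)) (C.continuous_integrand ψ ψ)
    (C.integrable_integrand ψ ψ) fun X X' => ?_
  have h : inner ℂ ((weyl (X : Phase ℝ n) ψ).toLp 2 volume)
      ((weyl (X' : Phase ℝ n) ψ).toLp 2 volume)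
      = l2 (weyl (X : Phase ℝ n) ψ) (weyl (X' : Phase ℝ n) ψ) := by
    refine (SchwartzMap.inner_toL2_toL2_eq _ _ volume).trans ?_
    rw [l2]
    congr 1
    funext ξ
    rw [RCLike.inner_apply, mul_comm]
  rw [h, ← l2_weyl_weyl (-(X : Phase ℝ n)), weyl_neg_weyl, weyl_weyl, sympl_comm,
    sympl_neg_right, C.isotropic _ X'.2 _ X.2]
  simp [sub_eq_neg_add]

/-- The Schwartz space `𝓢(ℝⁿ, 𝓛_k)`, that is `𝓢(ℝⁿ)` with the inner product `form`. -/
def PreState (_C : ConstraintPlane n k) : Type := Wave n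

instance : AddCommGroup C.PreState := inferInstanceAs (AddCommGroup (Wave n))

instance : Module ℂ C.PreState := inferInstanceAs (Module ℂ (Wave n))

/-- The form is Hermitian and positive semidefinite. -/
@[reducible]
def core : PreInnerProductSpace.Core ℂ C.PreState where
  inner ψ φ := C.form ψ φ
  conj_inner_symm ψ φ := C.form_conj ψ φ
  re_inner_nonneg ψ := C.form_nonneg ψ
  add_left ψ ψ' φ := C.form_add_left ψ ψ' φ
  smul_left ψ φ c := C.form_smul_left c ψ φ

instance : SeminormedAddCommGroup C.PreState :=
  @InnerProductSpace.Core.toSeminormedAddCommGroup ℂ C.PreState _ _ _ C.core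

instance : InnerProductSpace ℂ C.PreState := InnerProductSpace.ofCore C.core

theorem inner_eq (ψ φ : C.PreState) : inner ℂ ψ φ = C.form ψ φ := rfl

/-- The quotient `𝓢(ℝⁿ, 𝓛_k)/∼` by the vectors of zero norm. -/
abbrev Quot : Type := SeparationQuotient C.PreState

/-- The class `[ψ]` in the quotient. -/
def cls (ψ : Wave n) : C.Quot := SeparationQuotient.mk (ψ : C.PreState)

theorem norm_eq (ψ : C.PreState) : ‖ψ‖ = √(C.form ψ ψ).re := rfl

theorem inseparable_iff (ψ φ : C.PreState) : Inseparable ψ φ ↔ ‖ψ - φ‖ = 0 := by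
  rw [Metric.inseparable_iff, dist_eq_norm]

theorem norm_eq_zero_iff (ψ : C.PreState) : ‖ψ‖ = 0 ↔ C.form ψ ψ = 0 := by
  rw [← C.inner_eq, inner_self_eq_norm_sq_to_K]
  simp

theorem cls_eq_cls_iff (ψ φ : Wave n) : C.cls ψ = C.cls φ ↔ C.form (ψ - φ) (ψ - φ) = 0 :=
  (SeparationQuotient.mk_eq_mk.trans (C.inseparable_iff ψ φ)).trans (C.norm_eq_zero_iff _)

/-- The physical Hilbert space: the completion of the quotient. -/
abbrev PhysSpace : Type := UniformSpace.Completion C.Quot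

/-- The skew-orthogonal complement `𝓛_k^{⊥ω}` in `ℝ^{2n}`. -/
def skewPerp : Set (Phase ℝ n) := {Y | ∀ X ∈ C.plane, sympl Y X = 0}

/-- The complexification `𝓛_k^ℂ ⊂ ℂ^{2n}`. -/
def planeC : Submodule ℂ (Phase ℂ n) := Submodule.span ℂ (toComplex '' (C.plane : Set (Phase ℝ n)))

/-- The skew-orthogonal complement `(𝓛_k^ℂ)^{⊥ω}` in `ℂ^{2n}`. -/
def skewPerpC : Set (Phase ℂ n) := {Y | ∀ X ∈ C.planeC, sympl Y X = 0}

theorem form_weyl_weyl {Y : Phase ℝ n} (hY : Y ∈ C.skewPerp) (ψ φ : Wave n) :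
    C.form (weyl Y ψ) (weyl Y φ) = C.form ψ φ := by
  rw [form, form]
  congr 1
  funext X
  have h : weyl (X : Phase ℝ n) (weyl Y φ) = weyl Y (weyl (X : Phase ℝ n) φ) := by
    rw [weyl_weyl, weyl_weyl, sympl_comm, hY _ X.2, add_comm]
    simp
  rw [h, l2_weyl_weyl]

theorem form_Omega {Y : Phase ℂ n} (hY : Y ∈ C.skewPerpC) (ψ φ : Wave n) :
    C.form ψ (Omega Y φ) = C.form (Omega (star Y) ψ) φ := by
  rw [form, form]
  congr 1
  funext X
  have h := Omega_weyl Y (X : Phase ℝ n) φ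
  rw [hY _ (Submodule.subset_span ⟨X, X.2, rfl⟩), zero_smul, add_zero] at h
  rw [← h, l2_Omega_right]

/-- `e^{iΩ(Y)}`, `Y ∈ 𝓛_k^{⊥ω}`, on classes: `e^{iΩ(Y)} [ψ] = [e^{iΩ(Y)} ψ]`. -/
def weylQuot (Y : C.skewPerp) : C.Quot →ₗᵢ[ℂ] C.Quot where
  toFun := SeparationQuotient.lift (fun ψ : C.PreState => C.cls (weyl (Y : Phase ℝ n) ψ)) (by
    intro ψ φ h
    have h' := (C.cls_eq_cls_iff ψ φ).1 (SeparationQuotient.mk_eq_mk.2 h)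
    rw [cls_eq_cls_iff]
    have e : weyl (Y : Phase ℝ n) (ψ : Wave n) - weyl (Y : Phase ℝ n) (φ : Wave n)
      = weyl (Y : Phase ℝ n) ((ψ : Wave n) - φ) := (map_sub _ _ _).symm
    exact (congrArg (fun a => C.form a a) e).trans ((C.form_weyl_weyl Y.2 _ _).trans h'))
  map_add' a b := by
    obtain ⟨ψ, rfl⟩ := SeparationQuotient.surjective_mk a
    obtain ⟨φ, rfl⟩ := SeparationQuotient.surjective_mk b
    exact congrArg C.cls (map_add (weyl (Y : Phase ℝ n)) (ψ : Wave n) φ)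
  map_smul' c a := by
    obtain ⟨ψ, rfl⟩ := SeparationQuotient.surjective_mk a
    exact congrArg C.cls (map_smul (weyl (Y : Phase ℝ n)) c (ψ : Wave n))
  norm_map' a := by
    obtain ⟨ψ, rfl⟩ := SeparationQuotient.surjective_mk a
    exact congrArg (fun z : ℂ => √z.re) (C.form_weyl_weyl Y.2 ψ ψ)

/-- `e^{iΩ(Y)}`, `Y ∈ 𝓛_k^{⊥ω}`, extended by continuity to the physical Hilbert space. -/
def weylPhys (Y : C.skewPerp) : C.PhysSpace →L[ℂ] C.PhysSpace :=
  (C.weylQuot Y).toContinuousLinearMap.completion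

theorem weylPhys_cls (Y : C.skewPerp) (ψ : Wave n) :
    C.weylPhys Y (C.cls ψ : C.PhysSpace) = (C.cls (weyl (Y : Phase ℝ n) ψ) : C.PhysSpace) :=
  ContinuousLinearMap.completion_apply_coe _ _

/-- `Ω(Y)`, `Y ∈ (𝓛_k^ℂ)^{⊥ω}`, on classes: `Ω(Y) [ψ] = [Ω(Y) ψ]`. -/
def omegaQuot (Y : C.skewPerpC) : C.Quot →ₗ[ℂ] C.Quot where
  toFun := SeparationQuotient.lift (fun ψ : C.PreState => C.cls (Omega (Y : Phase ℂ n) ψ)) (by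
    intro ψ φ h
    have h' := (C.cls_eq_cls_iff ψ φ).1 (SeparationQuotient.mk_eq_mk.2 h)
    rw [cls_eq_cls_iff]
    have e : Omega (Y : Phase ℂ n) (ψ : Wave n) - Omega (Y : Phase ℂ n) (φ : Wave n)
      = Omega (Y : Phase ℂ n) ((ψ : Wave n) - φ) := (map_sub _ _ _).symm
    refine (congrArg (fun a => C.form a a) e).trans ((C.form_Omega Y.2 _ _).trans ?_)
    set χ : C.PreState := Omega (star (Y : Phase ℂ n)) (Omega (Y : Phase ℂ n) ((ψ : Wave n) - φ))
    have h0 : ‖(ψ - φ : C.PreState)‖ = 0 := (C.inseparable_iff ψ φ).1 h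
    have h1 : ‖inner ℂ χ (ψ - φ : C.PreState)‖ ≤ ‖χ‖ * ‖(ψ - φ : C.PreState)‖ :=
      norm_inner_le_norm _ _
    rw [h0, mul_zero] at h1
    exact norm_le_zero_iff.1 h1)
  map_add' a b := by
    obtain ⟨ψ, rfl⟩ := SeparationQuotient.surjective_mk a
    obtain ⟨φ, rfl⟩ := SeparationQuotient.surjective_mk b
    exact congrArg C.cls (map_add (Omega (Y : Phase ℂ n)) (ψ : Wave n) φ)
  map_smul' c a := by
    obtain ⟨ψ, rfl⟩ := SeparationQuotient.surjective_mk a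
    exact congrArg C.cls (map_smul (Omega (Y : Phase ℂ n)) c (ψ : Wave n))

theorem omegaQuot_cls (Y : C.skewPerpC) (ψ : Wave n) :
    C.omegaQuot Y (C.cls ψ) = C.cls (Omega (Y : Phase ℂ n) ψ) := rfl

theorem star_mem_skewPerpC {Y : Phase ℂ n} (hY : Y ∈ C.skewPerpC) : star Y ∈ C.skewPerpC := by
  intro X hX
  have h1 : ∀ Z W : Phase ℂ n, sympl (star Z) W = star (sympl Z (star W)) := by
    intro Z W
    simp [sympl, mul_comm]
  have h2 : star X ∈ C.planeC := by
    refine Submodule.span_induction (p := fun X _ => star X ∈ C.planeC) ?_ ?_ ?_ ?_ hX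
    · rintro _ ⟨W, hW, rfl⟩
      refine Submodule.subset_span ⟨W, hW, ?_⟩
      ext j <;> simp [toComplex]
    · simp
    · intro a b _ _ ha hb
      rw [star_add]
      exact add_mem ha hb
    · intro c a _ ha
      rw [star_smul]
      exact C.planeC.smul_mem _ ha
  rw [h1, hY _ h2, star_zero]

/-- The H-germ `ř` of `ψ`: the `Y` for which `Ω(Y)` acts on classes and `‖Ω(Y) [ψ]‖ = 0`. -/
def germ (ψ : Wave n) : Set (Phase ℂ n) :=
  {Y | ∃ hY : Y ∈ C.skewPerpC, ‖C.omegaQuot ⟨Y, hY⟩ (C.cls ψ)‖ = 0}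

/-- The complex conjugate `ř* = {Y* | Y ∈ ř}` of the H-germ. -/
def conjGerm (ψ : Wave n) : Set (Phase ℂ n) := {Z | ∃ Y ∈ C.germ ψ, Z = star Y}

theorem conjGerm_subset (ψ : Wave n) : C.conjGerm ψ ⊆ C.skewPerpC := by
  rintro _ ⟨Y, ⟨hY, -⟩, rfl⟩
  exact C.star_mem_skewPerpC hY

/-- `Ω(Z)`, `Z ∈ ř*`, on classes. -/
def creation (ψ : Wave n) (Z : C.conjGerm ψ) : C.Quot →ₗ[ℂ] C.Quot :=
  C.omegaQuot ⟨Z, C.conjGerm_subset ψ Z.2⟩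

end ConstraintPlane

/-- `ψ` is the Gaussian function `c exp ((i/2) ∑ ξ_j A_{jl} ξ_l)`, `c ≠ 0`, where `A` is a complex
symmetric matrix with positive definite imaginary part. -/
def IsGaussian {n : ℕ} (c : ℂ) (A : Matrix (Fin n) (Fin n) ℂ) (ψ : Wave n) : Prop :=
  c ≠ 0 ∧ A.IsSymm ∧ (A.map Complex.im).PosDef ∧
    ∀ ξ, ψ ξ = c * Complex.exp (Complex.I / 2 * ∑ j, ∑ l, (ξ j : ℂ) * A j l * (ξ l : ℂ))

end LinearConstraint

end

/-
The Moyal identity recovers every `⟨φ, ψ⟩` from the coefficients `⟨φ, e^{iΩ(Y)} g⟩`, `Y ∈ ℝ^{2n}`,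
so for any `g ≠ 0` the classes `[e^{iΩ(Y)} g]` have dense span in `𝓗`.

The matrix `A` defines a complex structure `J` on `ℝ^{2n}` with `Ω(J X) ψ_A = i Ω(X) ψ_A` and
`ω(J X, X) > 0` for `X ≠ 0`, whence `ℝ^{2n} = 𝓛_k^{⊥ω} + J 𝓛_k`. As `Ω(X)` vanishes on classes for
`X ∈ 𝓛_k`, the operator `e^{iΩ(J X)}` multiplies `[e^{iΩ(Y)} ψ_A]`, `Y ∈ 𝓛_k^{⊥ω}`, by a scalar. So
the translations along `𝓛_k^{⊥ω}` already suffice, which is the first claim.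

A `Y ∈ 𝓛_k^{⊥ω}` may be shifted by an element of `𝓛_k` so that `J Y ∈ 𝓛_k^{⊥ω}` too. Then
`Z = (Y + i J Y) / 2` lies in the germ and `Ω(Y) = Ω(Z) + Ω(Z*)`. The canonical commutation relation
bounds `‖Ω(Y)^m [ψ_A]‖²` by `K^m m! ‖[ψ_A]‖²`, so the exponential series of `e^{iΩ(Y)}` converges on
`[ψ_A]`, and moving `Ω(Z)` to the right makes its partial sums combinations of the `Ω(Z*)^p [ψ_A]`.
This is the second claim.
-/

namespace LinearConstraint

section CanonicalCommutation

theorem mul_pow_succ_of_commutator {R 𝔄 : Type*} [CommRing R] [Ring 𝔄] [Algebra R 𝔄] {a x : 𝔄}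
    {κ : R} (h : a * x = x * a + κ • 1) (m : ℕ) :
    a * x ^ (m + 1) = x ^ (m + 1) * a + ((m + 1) * κ) • x ^ m := by
  induction m with
  | zero => simpa using h
  | succ m ih =>
    calc a * x ^ (m + 2) = a * x * x ^ (m + 1) := by rw [pow_succ' x (m + 1), mul_assoc]
      _ = x * (a * x ^ (m + 1)) + κ • x ^ (m + 1) := by
        rw [h, add_mul, mul_assoc, smul_mul_assoc, one_mul]
      _ = x ^ (m + 2) * a + (((m + 1 : ℕ) + 1) * κ) • x ^ (m + 1) := by
        rw [ih, mul_add, ← mul_assoc, ← pow_succ', mul_smul_comm, ← pow_succ', add_assoc,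
          ← add_smul]
        push_cast
        ring_nf

theorem add_pow_apply_mem_span {R M : Type*} [CommRing R] [AddCommGroup M] [Module R M]
    {a b : Module.End R M} {κ : R} (hab : a * b = b * a + κ • 1) {v : M} (hv : a v = 0) (m : ℕ) :
    ((a + b) ^ m) v ∈ Submodule.span R (Set.range fun p : ℕ => (b ^ p) v) := by
  set S := Submodule.span R (Set.range fun p : ℕ => (b ^ p) v)
  have hmem (p : ℕ) : (b ^ p) v ∈ S := Submodule.subset_span ⟨p, rfl⟩
  have hb : S ≤ S.comap b := by
    refine Submodule.span_le.2 (Set.range_subset_iff.2 fun p => ?_)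
    simpa only [SetLike.mem_coe, Submodule.mem_comap, pow_succ', Module.End.mul_apply]
      using hmem (p + 1)
  have ha : S ≤ S.comap a := by
    refine Submodule.span_le.2 (Set.range_subset_iff.2 fun p => ?_)
    cases p with
    | zero => simp [hv]
    | succ p =>
      have := LinearMap.congr_fun (mul_pow_succ_of_commutator hab p) v
      simp only [Module.End.mul_apply, LinearMap.add_apply, LinearMap.smul_apply, hv, map_zero,
        zero_add] at this
      simpa only [SetLike.mem_coe, Submodule.mem_comap, this] using S.smul_mem _ (hmem p)
  induction m with
  | zero => exact hmem 0
  | succ m ih =>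
    rw [pow_succ', Module.End.mul_apply, LinearMap.add_apply]
    exact S.add_mem (ha ih) (hb ih)

variable {E : Type*} [SeminormedAddCommGroup E] [InnerProductSpace ℂ E] {a b : Module.End ℂ E}
  {κ : ℂ} {v : E}

theorem isSymmetric_add_of_adjoint (hadj : ∀ u w, inner ℂ (a u) w = inner ℂ u (b w)) :
    (a + b).IsSymmetric := fun u w => by
  rw [LinearMap.add_apply, LinearMap.add_apply, inner_add_left, inner_add_right, hadj u w,
    ← inner_conj_symm (b u) w, ← hadj w u, inner_conj_symm, add_comm]

theorem inner_add_pow_add_two (hadj : ∀ u w, inner ℂ (a u) w = inner ℂ u (b w))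
    (hab : a * b = b * a + κ • 1) (hv : a v = 0) (m : ℕ) :
    inner ℂ v (((a + b) ^ (m + 2)) v) = (m + 1) * κ * inner ℂ v (((a + b) ^ m) v) := by
  have hcomm : a * (a + b) = (a + b) * a + κ • 1 := by rw [mul_add, add_mul, hab, add_assoc]
  have hlower := LinearMap.congr_fun (mul_pow_succ_of_commutator hcomm m) v
  simp only [Module.End.mul_apply, LinearMap.add_apply, LinearMap.smul_apply, hv, map_zero,
    zero_add] at hlower
  rw [pow_succ' (a + b) (m + 1), Module.End.mul_apply, LinearMap.add_apply, inner_add_right,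
    ← hadj, hv, inner_zero_left, add_zero, hlower, inner_smul_right]

theorem norm_add_pow_apply_sq_le (hadj : ∀ u w, inner ℂ (a u) w = inner ℂ u (b w))
    (hab : a * b = b * a + κ • 1) (hv : a v = 0) (m : ℕ) :
    ‖((a + b) ^ m) v‖ ^ 2 ≤ (2 * ‖κ‖) ^ m * m.factorial * ‖v‖ ^ 2 := by
  have hmoment : ‖((a + b) ^ m) v‖ ^ 2 = ‖inner ℂ v (((a + b) ^ (2 * m)) v)‖ := by
    rw [two_mul, pow_add, Module.End.mul_apply,
      ← (isSymmetric_add_of_adjoint hadj).pow m v, inner_self_eq_norm_sq_to_K]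
    simp
  rw [hmoment]
  clear hmoment
  induction m with
  | zero => simp [inner_self_eq_norm_sq_to_K]
  | succ m ih =>
    have hodd : ‖((2 * m : ℕ) + 1 : ℂ)‖ ≤ 2 * (m + 1) := by
      rw [← Nat.cast_add_one, Complex.norm_natCast]
      push_cast
      linarith
    rw [mul_add_one, inner_add_pow_add_two hadj hab hv, norm_mul, norm_mul]
    calc ‖((2 * m : ℕ) + 1 : ℂ)‖ * ‖κ‖ * ‖inner ℂ v (((a + b) ^ (2 * m)) v)‖
        ≤ 2 * (m + 1) * ‖κ‖ * ((2 * ‖κ‖) ^ m * m.factorial * ‖v‖ ^ 2) := by gcongr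
      _ = (2 * ‖κ‖) ^ (m + 1) * (m + 1).factorial * ‖v‖ ^ 2 := by
        rw [Nat.factorial_succ]
        push_cast
        ring

theorem norm_sub_taylor_le {F : Type*} [NormedAddCommGroup F] [NormedSpace ℝ F] {f : ℕ → ℝ → F}
    (hf : ∀ m s, HasDerivAt (f m) (f (m + 1) s) s) {s t : ℝ} (hst : s ≤ t) {M : ℕ} {K : ℝ}
    (hK : ∀ y, ‖f (M + 1) y‖ ≤ K) :
    ‖f 0 t - ∑ m ∈ Finset.range (M + 1), ((t - s) ^ m / m.factorial) • f m s‖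
      ≤ K * (t - s) ^ (M + 1) / M.factorial := by
  have hiter (m : ℕ) : iteratedDeriv m (f 0) = f m := by
    induction m with
    | zero => rw [iteratedDeriv_zero]
    | succ m ih => rw [iteratedDeriv_succ, ih]; exact funext fun y => (hf m y).deriv
  have hsmooth (N : ℕ) : ContDiff ℝ N (f 0) := contDiff_of_differentiable_iteratedDeriv
    fun m _ => by rw [hiter]; exact fun y => (hf m y).differentiableAt
  rcases hst.eq_or_lt with rfl | hlt
  · simp [Finset.sum_range_succ']
  have hwithin (m : ℕ) {y : ℝ} (hy : y ∈ Set.Icc s t) :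
      iteratedDerivWithin m (f 0) (Set.Icc s t) y = f m y := by
    rw [iteratedDerivWithin_eq_iteratedDeriv (uniqueDiffOn_Icc hlt) (hsmooth m).contDiffAt hy,
      hiter]
  have key := taylor_mean_remainder_bound hst (hsmooth (M + 1)).contDiffOn
    (Set.right_mem_Icc.2 hst) fun y hy => (hwithin (M + 1) hy).symm ▸ hK y
  rw [taylor_within_apply] at key
  simpa only [hwithin _ (Set.left_mem_Icc.2 hst), div_eq_inv_mul] using key

variable {U : ℝ → E → E}

theorem norm_flow_sub_sum_le {x : Module.End ℂ E} (hU₀ : ∀ w, U 0 w = w)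
    (hU : ∀ t w, ‖U t w‖ ≤ ‖w‖)
    (hderiv : ∀ u w t, HasDerivAt (fun s => inner ℂ u (U s w))
      (Complex.I * inner ℂ u (U t (x w))) t) (v : E) (M : ℕ) :
    ‖U 1 v - ∑ m ∈ Finset.range (M + 1), (Complex.I ^ m / m.factorial) • (x ^ m) v‖
      ≤ ‖(x ^ (M + 1)) v‖ / M.factorial := by
  set D := U 1 v - ∑ m ∈ Finset.range (M + 1), (Complex.I ^ m / m.factorial) • (x ^ m) v with hD
  let f (m : ℕ) (s : ℝ) : ℂ := Complex.I ^ m * inner ℂ D (U s ((x ^ m) v))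
  have hf (m : ℕ) (s : ℝ) : HasDerivAt (f m) (f (m + 1) s) s := by
    refine ((hderiv D ((x ^ m) v) s).const_mul (Complex.I ^ m)).congr_deriv ?_
    rw [← Module.End.mul_apply, ← pow_succ', ← mul_assoc, ← pow_succ]
  have hbound (s : ℝ) : ‖f (M + 1) s‖ ≤ ‖D‖ * ‖(x ^ (M + 1)) v‖ := by
    rw [norm_mul, norm_pow, Complex.norm_I, one_pow, one_mul]
    exact (norm_inner_le_norm _ _).trans (by gcongr; exact hU _ _)
  have htaylor := norm_sub_taylor_le hf zero_le_one hbound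
  have hself : f 0 1 - ∑ m ∈ Finset.range (M + 1), (((1 : ℝ) - 0) ^ m / m.factorial) • f m 0
      = inner ℂ D D := by
    conv_rhs => enter [3]; rw [hD]
    rw [inner_sub_right, inner_sum]
    congr 1
    · simp only [f, pow_zero, Module.End.one_apply, one_mul]
    · refine Finset.sum_congr rfl fun m _ => ?_
      simp only [f, hU₀, inner_smul_right, sub_zero, one_pow, Complex.real_smul]
      push_cast
      ring
  rw [hself, inner_self_eq_norm_sq_to_K, sub_zero, one_pow, mul_one] at htaylor
  rcases (norm_nonneg D).eq_or_lt with h₀ | hpos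
  · rw [← h₀]
    positivity
  · refine le_of_mul_le_mul_left ?_ hpos
    calc ‖D‖ * ‖D‖ = ‖((‖D‖ : ℂ)) ^ 2‖ := by simp [sq]
      _ ≤ ‖D‖ * ‖(x ^ (M + 1)) v‖ / M.factorial := htaylor
      _ = ‖D‖ * (‖(x ^ (M + 1)) v‖ / M.factorial) := mul_div_assoc _ _ _

theorem tendsto_norm_add_pow_apply_div_factorial
    (hadj : ∀ u w, inner ℂ (a u) w = inner ℂ u (b w)) (hab : a * b = b * a + κ • 1)
    (hv : a v = 0) :
    Tendsto (fun M : ℕ => ‖((a + b) ^ (M + 1)) v‖ / M.factorial) atTop (𝓝 0) := by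
  have hsq : Tendsto (fun M : ℕ => (‖((a + b) ^ (M + 1)) v‖ / M.factorial) ^ 2) atTop (𝓝 0) := by
    have hlim := (FloorSemiring.tendsto_pow_div_factorial_atTop (4 * ‖κ‖)).const_mul
      (2 * ‖κ‖ * ‖v‖ ^ 2)
    rw [mul_zero] at hlim
    refine squeeze_zero (fun M => by positivity) (fun M => ?_) hlim
    have hpow : ((M : ℝ) + 1) ≤ 2 ^ M := by exact_mod_cast M.lt_two_pow_self
    rw [div_pow, div_le_iff₀ (by positivity)]
    calc ‖((a + b) ^ (M + 1)) v‖ ^ 2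
        ≤ (2 * ‖κ‖) ^ (M + 1) * (M + 1).factorial * ‖v‖ ^ 2 :=
          norm_add_pow_apply_sq_le hadj hab hv _
      _ = (2 * ‖κ‖) ^ (M + 1) * ((M + 1) * M.factorial) * ‖v‖ ^ 2 := by
        rw [Nat.factorial_succ, Nat.cast_mul, Nat.cast_add_one]
      _ ≤ (2 * ‖κ‖) ^ (M + 1) * (2 ^ M * M.factorial) * ‖v‖ ^ 2 := by gcongr
      _ = 2 * ‖κ‖ * ‖v‖ ^ 2 * ((4 * ‖κ‖) ^ M / M.factorial) * (M.factorial : ℝ) ^ 2 := by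
        rw [show 4 * ‖κ‖ = 2 * ‖κ‖ * 2 by ring, mul_pow (2 * ‖κ‖) 2, pow_succ]
        field_simp
  simpa only [Real.sqrt_sq_eq_abs, abs_of_nonneg, div_nonneg, norm_nonneg, Nat.cast_nonneg,
    Real.sqrt_zero] using hsq.sqrt

theorem flow_mem_closure_span_pow (hadj : ∀ u w, inner ℂ (a u) w = inner ℂ u (b w))
    (hab : a * b = b * a + κ • 1) (hv : a v = 0) (hU₀ : ∀ w, U 0 w = w)
    (hU : ∀ t w, ‖U t w‖ ≤ ‖w‖)
    (hderiv : ∀ u w t, HasDerivAt (fun s => inner ℂ u (U s w))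
      (Complex.I * inner ℂ u (U t ((a + b) w))) t) :
    U 1 v ∈ closure (Submodule.span ℂ (Set.range fun p : ℕ => (b ^ p) v) : Set E) := by
  have hlim := tendsto_iff_norm_sub_tendsto_zero.2 <|
    squeeze_zero (fun M => norm_nonneg _)
      (fun M => (norm_sub_rev _ _).trans_le (norm_flow_sub_sum_le hU₀ hU hderiv v M))
      (tendsto_norm_add_pow_apply_div_factorial hadj hab hv)
  exact mem_closure_of_tendsto hlim (.of_forall fun M => Submodule.sum_mem _ fun m _ =>
    Submodule.smul_mem _ _ (add_pow_apply_mem_span hab hv m))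

end CanonicalCommutation

section Symplectic

open Matrix

variable {R : Type} [CommRing R] {n : ℕ}

theorem sympl_eq_dotProduct (X Y : Phase R n) : sympl X Y = X.1 ⬝ᵥ Y.2 - Y.1 ⬝ᵥ X.2 := by
  simp only [sympl, dotProduct, Finset.sum_sub_distrib]

theorem sympl_add_left (X X' Y : Phase R n) : sympl (X + X') Y = sympl X Y + sympl X' Y := by
  simp only [sympl_eq_dotProduct, Prod.fst_add, Prod.snd_add, add_dotProduct, dotProduct_add]
  ring

theorem sympl_add_right (X Y Y' : Phase R n) : sympl X (Y + Y') = sympl X Y + sympl X Y' := by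
  simp only [sympl_eq_dotProduct, Prod.fst_add, Prod.snd_add, add_dotProduct, dotProduct_add]
  ring

theorem sympl_smul_left (r : R) (X Y : Phase R n) : sympl (r • X) Y = r * sympl X Y := by
  simp only [sympl_eq_dotProduct, Prod.smul_fst, Prod.smul_snd, smul_dotProduct, dotProduct_smul,
    smul_eq_mul, mul_sub]

theorem sympl_smul_right (r : R) (X Y : Phase R n) : sympl X (r • Y) = r * sympl X Y := by
  simp only [sympl_eq_dotProduct, Prod.smul_fst, Prod.smul_snd, smul_dotProduct, dotProduct_smul,
    smul_eq_mul, mul_sub]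

/-- The symplectic form `sympl` bundled as a bilinear form, to which the linear algebra of bilinear
forms applies. -/
def symplBilin (R : Type) [CommRing R] (n : ℕ) : LinearMap.BilinForm R (Phase R n) :=
  LinearMap.mk₂ R sympl sympl_add_left sympl_smul_left sympl_add_right sympl_smul_right

theorem symplBilin_apply (X Y : Phase R n) : symplBilin R n X Y = sympl X Y := rfl

theorem sympl_sub_left (X X' Y : Phase R n) : sympl (X - X') Y = sympl X Y - sympl X' Y := by
  simp only [← symplBilin_apply, map_sub, LinearMap.sub_apply]

end Symplectic

section OmegaAlgebra

variable {n : ℕ}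

theorem star_toComplex (X : Phase ℝ n) : star (toComplex X) = toComplex X := by
  ext j <;> simp [toComplex]

theorem Omega_add (Y Z : Phase ℂ n) : Omega (Y + Z) = Omega Y + Omega Z := by
  ext1 ψ
  simp only [Omega_eq, _root_.add_apply, Prod.fst_add, Prod.snd_add, Pi.add_apply, mul_add,
    add_smul, ← Finset.sum_add_distrib]
  exact Finset.sum_congr rfl fun j _ => by abel

theorem Omega_smul (r : ℂ) (Y : Phase ℂ n) : Omega (r • Y) = r • Omega Y := by
  ext1 ψ
  simp only [Omega_eq, _root_.smul_apply, Prod.smul_fst, Prod.smul_snd, Pi.smul_apply, smul_eq_mul,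
    Finset.smul_sum, smul_add, smul_smul, mul_left_comm]

theorem coordOp_comm (j l : Fin n) (ψ : Wave n) :
    coordOp j (coordOp l ψ) = coordOp l (coordOp j ψ) := by
  ext ξ
  simp only [coordOp_apply, mul_left_comm]

theorem partialOp_coordOp (j l : Fin n) (ψ : Wave n) :
    partialOp j (coordOp l ψ) = coordOp l (partialOp j ψ) + if j = l then ψ else 0 := by
  ext ξ
  have hcoord : HasFDerivAt (fun ξ : EuclideanSpace ℝ (Fin n) => ((ξ l : ℝ) : ℂ))
      (Complex.ofRealCLM.comp (EuclideanSpace.proj l)) ξ :=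
    (Complex.ofRealCLM.comp (EuclideanSpace.proj l)).hasFDerivAt
  have hmul : ⇑(coordOp l ψ) = fun ξ => ((ξ l : ℝ) : ℂ) * ψ ξ :=
    funext fun ξ => coordOp_apply l ψ ξ
  have hrhs : (coordOp l (partialOp j ψ) + if j = l then ψ else 0 : Wave n) ξ
      = coordOp l (partialOp j ψ) ξ + if j = l then ψ ξ else 0 := by
    split_ifs <;> rfl
  rw [hrhs, partialOp_apply, hmul, (hcoord.fun_mul (ψ.hasFDerivAt ξ)).fderiv, coordOp_apply,
    partialOp_apply]
  by_cases hjl : j = l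
  · simp [hjl]
  · simp [hjl, Ne.symm hjl]

theorem partialOp_comm (j l : Fin n) (ψ : Wave n) :
    partialOp j (partialOp l ψ) = partialOp l (partialOp j ψ) := by
  ext ξ
  have hsecond (i m : Fin n) : partialOp i (partialOp m ψ) ξ
      = fderiv ℝ (fderiv ℝ ψ) ξ (EuclideanSpace.single i 1) (EuclideanSpace.single m 1) := by
    have hdiff : DifferentiableAt ℝ (fderiv ℝ ψ) ξ :=
      ((ψ.smooth 2).fderiv_right (m := 1) le_rfl).differentiable one_ne_zero ξ
    rw [partialOp_apply, funext fun ζ => partialOp_apply m ψ ζ,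
      fderiv_clm_apply hdiff (differentiableAt_const _)]
    simp
  rw [hsecond, hsecond]
  exact ((ψ.smooth 2).contDiffAt.isSymmSndFDerivAt (by simp)).eq _ _

theorem Omega_coordOp (W : Phase ℂ n) (j : Fin n) (ψ : Wave n) :
    Omega W (coordOp j ψ) = coordOp j (Omega W ψ) + (Complex.I * W.2 j) • ψ := by
  simp only [Omega_eq, map_sum, map_add, map_smul, partialOp_coordOp, coordOp_comm j, smul_add,
    Finset.sum_add_distrib, smul_ite, smul_zero, Finset.sum_ite_eq', Finset.mem_univ, if_true,
    add_assoc]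

theorem Omega_partialOp (W : Phase ℂ n) (j : Fin n) (ψ : Wave n) :
    Omega W (partialOp j ψ) = partialOp j (Omega W ψ) - W.1 j • ψ := by
  simp only [Omega_eq, map_sum, map_add, map_smul, partialOp_coordOp, partialOp_comm j, smul_add,
    Finset.sum_add_distrib, smul_ite, smul_zero, Finset.sum_ite_eq, Finset.mem_univ, if_true]
  abel

theorem Omega_comm (Z W : Phase ℂ n) (ψ : Wave n) :
    Omega Z (Omega W ψ) = Omega W (Omega Z ψ) + (-Complex.I * sympl Z W) • ψ := by
  rw [Omega_eq Z ψ, Omega_eq Z (Omega W ψ), sympl, Finset.mul_sum, Finset.sum_smul, map_sum,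
    ← Finset.sum_add_distrib]
  refine Finset.sum_congr rfl fun j _ => ?_
  rw [map_add, map_smul, map_smul, Omega_coordOp, Omega_partialOp]
  module

end OmegaAlgebra

section ComplexStructure

open Matrix

variable {n : ℕ} {A : Matrix (Fin n) (Fin n) ℂ}

/-- The complex structure `J` on `ℝ^{2n}` attached to a symmetric matrix `A` with positive definite
imaginary part. It is determined by the requirement that `J X - i X` lies in the Lagrangian subspace
`P = A Q` of `ℂ^{2n}`, whose operators `Ω` annihilate the Gaussian function of `A`. -/
noncomputable def complexStructure (A : Matrix (Fin n) (Fin n) ℂ) : Phase ℝ n →ₗ[ℝ] Phase ℝ n :=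
  let q : Phase ℝ n →ₗ[ℝ] Fin n → ℝ := (A.map Complex.im)⁻¹.mulVecLin ∘ₗ
    ((A.map Complex.re).mulVecLin ∘ₗ LinearMap.snd ℝ _ _ - LinearMap.fst ℝ _ _)
  ((A.map Complex.im).mulVecLin ∘ₗ LinearMap.snd ℝ _ _ + (A.map Complex.re).mulVecLin ∘ₗ q).prod q

theorem complexStructure_snd (X : Phase ℝ n) : (complexStructure A X).2
    = (A.map Complex.im)⁻¹ *ᵥ (A.map Complex.re *ᵥ X.2 - X.1) := rfl

theorem complexStructure_fst (X : Phase ℝ n) : (complexStructure A X).1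
    = A.map Complex.im *ᵥ X.2 + A.map Complex.re *ᵥ (complexStructure A X).2 := rfl

theorem sympl_complexStructure_self (hA : A.IsSymm) (X : Phase ℝ n) :
    sympl (complexStructure A X) X = X.2 ⬝ᵥ A.map Complex.im *ᵥ X.2 +
      (A.map Complex.re *ᵥ X.2 - X.1) ⬝ᵥ
        (A.map Complex.im)⁻¹ *ᵥ (A.map Complex.re *ᵥ X.2 - X.1) := by
  have hre := dotProduct_transpose_mulVec (A.map Complex.re) X.2 (complexStructure A X).2
  rw [(hA.map Complex.re).eq] at hre
  rw [← complexStructure_snd, sympl_eq_dotProduct, complexStructure_fst, add_dotProduct,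
    sub_dotProduct, dotProduct_comm _ X.2, dotProduct_comm _ X.2, hre,
    dotProduct_comm (A.map Complex.re *ᵥ X.2)]
  ring

theorem sympl_complexStructure_self_pos (hA : A.IsSymm) (hpos : (A.map Complex.im).PosDef)
    {X : Phase ℝ n} (hX : X ≠ 0) : 0 < sympl (complexStructure A X) X := by
  rw [sympl_complexStructure_self hA]
  by_cases hQ : X.2 = 0
  · have hP : A.map Complex.re *ᵥ X.2 - X.1 ≠ 0 := by
      rw [hQ, mulVec_zero, zero_sub, neg_ne_zero]
      exact fun hP => hX (Prod.ext hP hQ)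
    exact add_pos_of_nonneg_of_pos (hpos.posSemidef.dotProduct_mulVec_nonneg X.2)
      (hpos.inv.dotProduct_mulVec_pos hP)
  · exact add_pos_of_pos_of_nonneg (hpos.dotProduct_mulVec_pos hQ)
      (hpos.inv.posSemidef.dotProduct_mulVec_nonneg _)

theorem fst_complexStructure_sub_I_smul (hpos : (A.map Complex.im).PosDef) (X : Phase ℝ n) :
    (toComplex (complexStructure A X) - Complex.I • toComplex X).1
      = A *ᵥ (toComplex (complexStructure A X) - Complex.I • toComplex X).2 := by
  have him : A.map Complex.im *ᵥ (complexStructure A X).2 = A.map Complex.re *ᵥ X.2 - X.1 := by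
    rw [complexStructure_snd, mulVec_mulVec,
      mul_nonsing_inv _ ((isUnit_iff_isUnit_det _).1 hpos.isUnit), one_mulVec]
  funext j
  have hfst := congrFun (complexStructure_fst (A := A) X) j
  have him := congrFun him j
  simp only [mulVec, dotProduct, map_apply, Pi.add_apply, Pi.sub_apply] at hfst him
  apply Complex.ext
  · simp [toComplex, mulVec, dotProduct, Finset.sum_add_distrib, hfst]
    ring
  · simp [toComplex, mulVec, dotProduct, Finset.sum_add_distrib]
    linarith

theorem exists_mem_forall_apply_eq {K V : Type*} [Field K] [AddCommGroup V] [Module K V]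
    (B : LinearMap.BilinForm K V) (L : Submodule K V) [FiniteDimensional K L]
    (hB : ∀ x ∈ L, B x x = 0 → x = 0) (ℓ : Module.Dual K V) : ∃ x ∈ L, ∀ y ∈ L, B x y = ℓ y := by
  have hinj : Function.Injective (B.restrict L) := by
    refine (injective_iff_map_eq_zero _).2 fun x hx => Subtype.ext ?_
    exact hB x x.2 (LinearMap.congr_fun hx x)
  obtain ⟨x, hx⟩ := (LinearMap.injective_iff_surjective_of_finrank_eq_finrank
    Subspace.dual_finrank_eq.symm).1 hinj (ℓ ∘ₗ L.subtype)
  exact ⟨x, x.2, fun y hy => LinearMap.congr_fun hx ⟨y, hy⟩⟩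

end ComplexStructure

namespace IsGaussian

open Matrix

variable {n : ℕ} {c : ℂ} {A : Matrix (Fin n) (Fin n) ℂ} {ψ : Wave n}

theorem ne_zero (h : IsGaussian c A ψ) : ψ ≠ 0 :=
  fun hzero => h.1 (by simpa [hzero] using (h.2.2.2 0).symm)

theorem apply_eq (h : IsGaussian c A ψ) (ξ : EuclideanSpace ℝ (Fin n)) :
    ψ ξ = c * Complex.exp (Complex.I / 2 *
      ((fun j => (ξ j : ℂ)) ⬝ᵥ A *ᵥ fun j => (ξ j : ℂ))) := by
  simp only [h.2.2.2 ξ, dotProduct, mulVec, Finset.mul_sum, mul_assoc]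

theorem fderiv_apply (h : IsGaussian c A ψ) (ξ v : EuclideanSpace ℝ (Fin n)) :
    fderiv ℝ ψ ξ v
      = Complex.I * ((fun j => (v j : ℂ)) ⬝ᵥ A *ᵥ fun j => (ξ j : ℂ)) * ψ ξ := by
  set x : Fin n → ℂ := fun j => (ξ j : ℂ) with hx
  set w : Fin n → ℂ := fun j => (v j : ℂ) with hw
  have hsymm : x ⬝ᵥ A *ᵥ w = w ⬝ᵥ A *ᵥ x := by
    simpa only [h.2.1.eq] using dotProduct_transpose_mulVec A x w
  have hline (t : ℝ) : ψ (ξ + t • v) = c * Complex.exp (Complex.I / 2 *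
      (x ⬝ᵥ A *ᵥ x + (t : ℂ) * (2 * w ⬝ᵥ A *ᵥ x) + (t : ℂ) ^ 2 * w ⬝ᵥ A *ᵥ w)) := by
    have hcoord : (fun j => (((ξ + t • v) j : ℝ) : ℂ)) = x + (t : ℂ) • w := by
      ext j
      simp [hx, hw]
    rw [h.apply_eq, hcoord]
    simp only [mulVec_add, mulVec_smul, add_dotProduct, dotProduct_add, smul_dotProduct,
      dotProduct_smul, smul_eq_mul, hsymm]
    ring_nf
  have ht : HasDerivAt (fun t : ℝ => (t : ℂ)) 1 0 := Complex.ofRealCLM.hasDerivAt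
  have hexp := (((((ht.mul_const (2 * w ⬝ᵥ A *ᵥ x)).const_add (x ⬝ᵥ A *ᵥ x)).fun_add
    ((ht.fun_pow 2).mul_const (w ⬝ᵥ A *ᵥ w))).const_mul (Complex.I / 2)).cexp).const_mul c
  rw [← (ψ.differentiableAt).lineDeriv_eq_fderiv, lineDeriv, funext hline, hexp.deriv, h.apply_eq]
  simp
  ring

theorem Omega_eq_zero (h : IsGaussian c A ψ) {Y : Phase ℂ n} (hY : Y.1 = A *ᵥ Y.2) :
    Omega Y ψ = 0 := by
  ext ξ
  set x : Fin n → ℂ := fun j => (ξ j : ℂ) with hx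
  have hfderiv (j : Fin n) :
      fderiv ℝ ψ ξ (EuclideanSpace.single j 1) = Complex.I * (A *ᵥ x) j * ψ ξ := by
    rw [h.fderiv_apply, ← hx, show (fun l => ((EuclideanSpace.single j (1 : ℝ) l : ℝ) : ℂ))
      = Pi.single j 1 by ext l; by_cases hl : l = j <;> simp [hl], single_one_dotProduct]
  have hsymm : Y.1 ⬝ᵥ x = Y.2 ⬝ᵥ A *ᵥ x := by
    rw [hY, dotProduct_comm, ← dotProduct_transpose_mulVec, h.2.1.eq]
  calc Omega Y ψ ξ = (Y.1 ⬝ᵥ x + Complex.I * Complex.I * Y.2 ⬝ᵥ A *ᵥ x) * ψ ξ := by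
        rw [Omega_apply, dotProduct, dotProduct, Finset.mul_sum, ← Finset.sum_add_distrib,
          Finset.sum_mul]
        exact Finset.sum_congr rfl fun j _ => by rw [hfderiv]; ring
    _ = 0 := by rw [hsymm, Complex.I_mul_I]; ring

theorem Omega_complexStructure (h : IsGaussian c A ψ) (X : Phase ℝ n) :
    Omega (toComplex (complexStructure A X)) ψ = Complex.I • Omega (toComplex X) ψ := by
  have hzero := h.Omega_eq_zero (fst_complexStructure_sub_I_smul h.2.2.1 X)
  rwa [sub_eq_add_neg, ← neg_smul, Omega_add, Omega_smul, _root_.add_apply, _root_.smul_apply,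
    neg_smul, add_neg_eq_zero] at hzero

end IsGaussian

theorem eq_exp_mul_of_hasDerivAt {f : ℝ → ℂ} {a b : ℂ}
    (hf : ∀ s : ℝ, HasDerivAt f ((s * a + b) * f s) s) (t : ℝ) :
    f t = Complex.exp (t ^ 2 * (a / 2) + t * b) * f 0 := by
  have hconst (s : ℝ) : HasDerivAt
      (fun t : ℝ => Complex.exp (-((t : ℂ) ^ 2 * (a / 2) + t * b)) * f t) 0 s := by
    have hs : HasDerivAt (fun t : ℝ => (t : ℂ)) 1 s := Complex.ofRealCLM.hasDerivAt
    refine ((((hs.fun_pow 2).mul_const (a / 2)).fun_add (hs.mul_const b)).fun_neg.cexp.fun_mul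
      (hf s)).congr_deriv ?_
    simp
    ring
  have heq := is_const_of_deriv_eq_zero (fun s => (hconst s).differentiableAt)
    (fun s => (hconst s).deriv) t 0
  rw [Complex.exp_neg] at heq
  simpa [inv_mul_eq_iff_eq_mul₀] using heq

section Decay

theorem inv_one_add_norm_add_pow_le {V : Type*} [SeminormedAddCommGroup V] (x y : V) (m : ℕ) :
    ((1 + ‖x + y‖) ^ m)⁻¹ ≤ (1 + ‖y‖) ^ m * ((1 + ‖x‖) ^ m)⁻¹ := by
  have hpeetre : 1 + ‖x‖ ≤ (1 + ‖x + y‖) * (1 + ‖y‖) := by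
    have htri : ‖x‖ ≤ ‖x + y‖ + ‖y‖ := by
      simpa only [add_sub_cancel_right] using norm_sub_le (x + y) y
    nlinarith [mul_nonneg (norm_nonneg (x + y)) (norm_nonneg y)]
  rw [inv_le_iff_one_le_mul₀' (by positivity), ← mul_assoc, ← mul_pow, ← div_eq_mul_inv,
    one_le_div (by positivity)]
  gcongr

theorem integrable_inv_one_add_norm_pow {V : Type*} [NormedAddCommGroup V] [NormedSpace ℝ V]
    [FiniteDimensional ℝ V] [MeasurableSpace V] [BorelSpace V] (μ : Measure V)
    [μ.IsAddHaarMeasure] {m : ℕ} (hm : Module.finrank ℝ V < m) :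
    Integrable (fun x : V => ((1 + ‖x‖) ^ m)⁻¹) μ := by
  refine (integrable_one_add_norm (μ := μ) (r := m) (by exact_mod_cast hm)).congr
    (.of_forall fun x => ?_)
  simp only [Real.rpow_neg (by positivity : (0 : ℝ) ≤ 1 + ‖x‖), Real.rpow_natCast]

variable {n : ℕ}

theorem exists_norm_l2_weyl_le (m : ℕ) (ψ φ : Wave n) :
    ∃ K, 0 ≤ K ∧ ∀ X : Phase ℝ n, ‖l2 ψ (weyl X φ)‖ ≤ K * ((1 + ‖X‖) ^ m)⁻¹ := by
  obtain ⟨K₀, h₀⟩ := norm_l2_weyl_le ψ φ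
  obtain ⟨Kₘ, hₘ⟩ := decay_l2_weyl m ψ φ
  have hbound (X : Phase ℝ n) :
      ‖l2 ψ (weyl X φ)‖ ≤ 2 ^ (m - 1) * (K₀ + Kₘ) * ((1 + ‖X‖) ^ m)⁻¹ := by
    rw [← div_eq_mul_inv, le_div_iff₀ (by positivity)]
    calc ‖l2 ψ (weyl X φ)‖ * (1 + ‖X‖) ^ m
        ≤ ‖l2 ψ (weyl X φ)‖ * (2 ^ (m - 1) * (1 ^ m + ‖X‖ ^ m)) := by
          gcongr
          exact add_pow_le zero_le_one (norm_nonneg X) m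
      _ = 2 ^ (m - 1) * (‖l2 ψ (weyl X φ)‖ + ‖X‖ ^ m * ‖l2 ψ (weyl X φ)‖) := by ring
      _ ≤ 2 ^ (m - 1) * (K₀ + Kₘ) := by gcongr; exacts [h₀ X, hₘ X]
  exact ⟨_, by simpa using (norm_nonneg _).trans (hbound 0), hbound⟩

theorem norm_l2_weyl_weyl (X X' : Phase ℝ n) (ψ φ : Wave n) :
    ‖l2 ψ (weyl X (weyl X' φ))‖ = ‖l2 ψ (weyl (X + X') φ)‖ := by
  have hphase : ‖Complex.exp (Complex.I / 2 * (sympl X X' : ℝ))‖ = 1 := by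
    rw [Complex.norm_exp]
    simp
  rw [weyl_weyl, l2_smul_right, norm_mul, hphase, one_mul]

theorem exists_norm_l2_weyl_weyl_le (m : ℕ) (ψ φ : Wave n) :
    ∃ K, 0 ≤ K ∧ ∀ X Y : Phase ℝ n,
      ‖l2 ψ (weyl X (weyl Y φ))‖ ≤ K * (1 + ‖Y‖) ^ m * ((1 + ‖X‖) ^ m)⁻¹ := by
  obtain ⟨K, hK₀, hK⟩ := exists_norm_l2_weyl_le m ψ φ
  refine ⟨K, hK₀, fun X Y => ?_⟩
  rw [norm_l2_weyl_weyl, mul_assoc]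
  exact (hK _).trans (by gcongr; exact inv_one_add_norm_add_pow_le X Y m)

theorem Omega_weyl_smul_self (Y : Phase ℝ n) (s : ℝ) (ψ : Wave n) :
    Omega (toComplex Y) (weyl (s • Y) ψ) = weyl (s • Y) (Omega (toComplex Y) ψ) := by
  rw [Omega_weyl, sympl_toComplex, sympl_smul_right, sympl_self, mul_zero, Complex.ofReal_zero,
    zero_smul, add_zero]

theorem norm_weyl_apply_le (X : Phase ℝ n) (ψ : Wave n) (ξ : EuclideanSpace ℝ (Fin n)) :
    ‖weyl X ψ ξ‖ ≤ SchwartzMap.seminorm ℝ 0 0 ψ := by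
  rw [weyl_apply, norm_mul, norm_weylPhase, one_mul]
  exact SchwartzMap.norm_le_seminorm ℝ ψ _

theorem hasDerivAt_l2_weyl (φ ψ : Wave n) (Y : Phase ℝ n) (s : ℝ) :
    HasDerivAt (fun t : ℝ => l2 φ (weyl (t • Y) ψ))
      (Complex.I * l2 φ (weyl (s • Y) (Omega (toComplex Y) ψ))) s := by
  have hbound (t : ℝ) (ξ : EuclideanSpace ℝ (Fin n)) :
      ‖conj (φ ξ) * (Complex.I * weyl (t • Y) (Omega (toComplex Y) ψ) ξ)‖
        ≤ ‖φ ξ‖ * SchwartzMap.seminorm ℝ 0 0 (Omega (toComplex Y) ψ) := by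
    rw [norm_mul, norm_mul, Complex.norm_I, one_mul, RCLike.norm_conj]
    gcongr
    exact norm_weyl_apply_le _ _ _
  have hderiv (t : ℝ) (ξ : EuclideanSpace ℝ (Fin n)) :
      HasDerivAt (fun t : ℝ => conj (φ ξ) * weyl (t • Y) ψ ξ)
        (conj (φ ξ) * (Complex.I * weyl (t • Y) (Omega (toComplex Y) ψ) ξ)) t := by
    rw [← Omega_weyl_smul_self]
    exact (hasDerivAt_weyl Y ψ ξ t).const_mul (conj (φ ξ))
  have key := hasDerivAt_integral_of_dominated_loc_of_deriv_le (μ := volume) (𝕜 := ℝ)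
    (F := fun t ξ => conj (φ ξ) * weyl (t • Y) ψ ξ)
    (F' := fun t ξ => conj (φ ξ) * (Complex.I * weyl (t • Y) (Omega (toComplex Y) ψ) ξ))
    (bound := fun ξ => ‖φ ξ‖ * SchwartzMap.seminorm ℝ 0 0 (Omega (toComplex Y) ψ))
    (x₀ := s) (s := Set.univ) Filter.univ_mem
    (.of_forall fun t => (l2_integrable φ (weyl (t • Y) ψ)).aestronglyMeasurable)
    (l2_integrable φ _)
    (l2_integrable φ (Complex.I • weyl (s • Y) (Omega (toComplex Y) ψ))).aestronglyMeasurable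
    (.of_forall fun ξ t _ => hbound t ξ) (φ.integrable.norm.mul_const _)
    (.of_forall fun ξ t _ => hderiv t ξ)
  rw [← l2_smul_right]
  exact key.2

end Decay

namespace ConstraintPlane

variable {n k : ℕ} (C : ConstraintPlane n k)

theorem form_add_right (ψ φ φ' : Wave n) :
    C.form ψ (φ + φ') = C.form ψ φ + C.form ψ φ' := by
  rw [← form_conj, form_add_left, map_add, form_conj, form_conj]

theorem form_smul_right (r : ℂ) (ψ φ : Wave n) : C.form ψ (r • φ) = r * C.form ψ φ := by
  rw [← form_conj, form_smul_left, map_mul, form_conj, Complex.conj_conj]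

theorem hasDerivAt_form_weyl (φ ψ : Wave n) (Y : Phase ℝ n) (s : ℝ) :
    HasDerivAt (fun t : ℝ => C.form φ (weyl (t • Y) ψ))
      (Complex.I * C.form φ (weyl (s • Y) (Omega (toComplex Y) ψ))) s := by
  set χ := Omega (toComplex Y) ψ
  set m := Module.finrank ℝ C.plane + 1
  obtain ⟨K, hK₀, hK⟩ := exists_norm_l2_weyl_weyl_le m φ χ
  have hbound (X : C.plane) (t : ℝ) (ht : t ∈ Metric.ball s 1) :
      ‖Complex.I * l2 φ (weyl X (weyl (t • Y) χ))‖
        ≤ K * (1 + (|s| + 1) * ‖Y‖) ^ m * ((1 + ‖X‖) ^ m)⁻¹ := by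
    have htY : ‖t • Y‖ ≤ (|s| + 1) * ‖Y‖ := by
      rw [norm_smul, Real.norm_eq_abs]
      gcongr
      rw [Metric.mem_ball, Real.dist_eq] at ht
      linarith [abs_sub_abs_le_abs_sub t s]
    rw [norm_mul, Complex.norm_I, one_mul]
    refine (hK X (t • Y)).trans ?_
    rw [Submodule.coe_norm]
    gcongr
  have hderiv (X : C.plane) (t : ℝ) : HasDerivAt (fun t => l2 φ (weyl X (weyl (t • Y) ψ)))
      (Complex.I * l2 φ (weyl X (weyl (t • Y) χ))) t := by
    simpa only [← l2_weyl_right] using hasDerivAt_l2_weyl (weyl (-(X : Phase ℝ n)) φ) ψ Y t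
  refine (hasDerivAt_integral_of_dominated_loc_of_deriv_le (Metric.ball_mem_nhds s one_pos)
    (.of_forall fun t => (C.integrable_integrand φ _).aestronglyMeasurable)
    (C.integrable_integrand φ _)
    ((C.integrable_integrand φ _).const_mul Complex.I).aestronglyMeasurable
    (.of_forall hbound) ((integrable_inv_one_add_norm_pow C.μ (Nat.lt_succ_self _)).const_mul _)
    (.of_forall fun X t _ => hderiv X t)).2.congr_deriv ?_
  rw [integral_const_mul, form]

theorem form_weyl_of_mem {X : Phase ℝ n} (hX : X ∈ C.plane) (φ ψ : Wave n) :
    C.form φ (weyl X ψ) = C.form φ ψ := by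
  rw [form, form, ← integral_add_right_eq_self
    (fun X' : C.plane => l2 φ (weyl (X' : Phase ℝ n) ψ)) ⟨X, hX⟩]
  congr 1
  funext X'
  rw [weyl_weyl, C.isotropic _ X'.2 _ hX, Complex.ofReal_zero, mul_zero, Complex.exp_zero, one_smul,
    Submodule.coe_add]

theorem form_Omega_of_mem {X : Phase ℝ n} (hX : X ∈ C.plane) (φ ψ : Wave n) :
    C.form φ (Omega (toComplex X) ψ) = 0 := by
  have hderiv := C.hasDerivAt_form_weyl φ ψ X 0
  have hconst : (fun t : ℝ => C.form φ (weyl (t • X) ψ)) = fun _ => C.form φ ψ :=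
    funext fun t => C.form_weyl_of_mem (C.plane.smul_mem t hX) φ ψ
  rw [hconst, zero_smul, weyl_zero] at hderiv
  simpa using hderiv.unique (hasDerivAt_const 0 _)

theorem inner_cls (ψ φ : Wave n) : inner ℂ (C.cls ψ) (C.cls φ) = C.form ψ φ := rfl

theorem norm_cls_sq (ψ : Wave n) : ‖C.cls ψ‖ ^ 2 = (C.form ψ ψ).re := by
  rw [← inner_self_eq_norm_sq (𝕜 := ℂ), inner_cls]
  rfl

theorem surjective_cls : Function.Surjective C.cls :=
  SeparationQuotient.surjective_mk (X := C.PreState)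

theorem cls_add (ψ φ : Wave n) : C.cls (ψ + φ) = C.cls ψ + C.cls φ := rfl

theorem cls_smul (r : ℂ) (ψ : Wave n) : C.cls (r • ψ) = r • C.cls ψ := rfl

theorem cls_eq_of_form {ψ φ : Wave n} (h : ∀ χ, C.form χ ψ = C.form χ φ) : C.cls ψ = C.cls φ := by
  refine ext_inner_left ℂ fun u => ?_
  obtain ⟨χ, rfl⟩ := C.surjective_cls u
  exact h χ

end ConstraintPlane

section Moyal

variable {n : ℕ}

/-- The wave function `ξ ↦ conj (g (ξ - q)) ψ(ξ)`: the Fourier transform of `windowed g q ψ` is,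
up to phase and scaling, the short-time Fourier transform of `ψ` with window `g` at position `q`. -/
noncomputable def windowed (g : Wave n) (q : EuclideanSpace ℝ (Fin n)) (ψ : Wave n) : Wave n :=
  SchwartzMap.smulLeftCLM ℂ (fun ξ => conj (g (ξ - q))) ψ

theorem windowed_apply (g : Wave n) (q : EuclideanSpace ℝ (Fin n)) (ψ : Wave n)
    (ξ : EuclideanSpace ℝ (Fin n)) : windowed g q ψ ξ = conj (g (ξ - q)) * ψ ξ := by
  have hgrowth : Function.HasTemperateGrowth (fun ξ => conj (g (ξ - q))) :=
    (Complex.conjCLE : ℂ →L[ℝ] ℂ).hasTemperateGrowth.comp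
      (SchwartzMap.compSubConstCLM ℂ q g).hasTemperateGrowth
  rw [windowed, SchwartzMap.smulLeftCLM_apply_apply hgrowth, smul_eq_mul]

open FourierTransform in
theorem l2_weyl_eq_fourier (g ψ : Wave n) (P Q : Fin n → ℝ) :
    l2 (weyl (P, Q) g) ψ = Complex.exp (Complex.I * ((1 / 2 * ∑ j, P j * Q j : ℝ) : ℂ)) *
      𝓕 (windowed g (WithLp.toLp 2 Q) ψ) ((2 * Real.pi)⁻¹ • WithLp.toLp 2 P) := by
  rw [SchwartzMap.fourier_coe, Real.fourier_eq', ← integral_const_mul, l2]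
  congr 1
  funext ξ
  have hphase : -2 * Real.pi * inner ℝ ξ ((2 * Real.pi)⁻¹ • WithLp.toLp 2 P)
      = -∑ j, P j * ξ j := by
    rw [real_inner_smul_right]
    simp only [PiLp.inner_apply, RCLike.inner_apply, conj_trivial]
    field_simp
  rw [weyl_apply, map_mul, windowed_apply, smul_eq_mul, ← mul_assoc, ← mul_assoc, weylPhase,
    ← Complex.exp_conj, ← Complex.exp_add, hphase, map_mul, Complex.conj_I, Complex.conj_ofReal]
  congr 3
  push_cast
  ring

theorem l2_weyl_mul_l2_weyl_eq_inner_fourier (g φ ψ : Wave n) (P Q : Fin n → ℝ) :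
    l2 (weyl (P, Q) g) ψ * l2 φ (weyl (P, Q) g)
      = inner ℂ (FourierTransform.fourier (windowed g (WithLp.toLp 2 Q) φ)
            ((2 * Real.pi)⁻¹ • WithLp.toLp 2 P))
          (FourierTransform.fourier (windowed g (WithLp.toLp 2 Q) ψ)
            ((2 * Real.pi)⁻¹ • WithLp.toLp 2 P)) := by
  have hphase (θ : ℝ) :
      Complex.exp (Complex.I * θ) * conj (Complex.exp (Complex.I * θ)) = 1 := by
    rw [Complex.mul_conj, Complex.normSq_eq_norm_sq, mul_comm, Complex.norm_exp_ofReal_mul_I,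
      one_pow, Complex.ofReal_one]
  rw [← l2_conj (weyl (P, Q) g) φ, l2_weyl_eq_fourier, l2_weyl_eq_fourier, map_mul,
    RCLike.inner_apply, mul_mul_mul_comm, hphase, one_mul]

theorem integral_l2_weyl_mul_fst (g φ ψ : Wave n) (Q : Fin n → ℝ) :
    ∫ P : Fin n → ℝ, l2 (weyl (P, Q) g) ψ * l2 φ (weyl (P, Q) g)
      = (2 * Real.pi) ^ n * ∫ ξ, (conj (φ ξ) * ψ ξ) *
        (g (ξ - WithLp.toLp 2 Q) * conj (g (ξ - WithLp.toLp 2 Q))) := by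
  set u := windowed g (WithLp.toLp 2 Q) φ
  set v := windowed g (WithLp.toLp 2 Q) ψ
  simp only [l2_weyl_mul_l2_weyl_eq_inner_fourier]
  rw [(PiLp.volume_preserving_toLp (Fin n)).integral_comp
      (MeasurableEquiv.toLp 2 (Fin n → ℝ)).measurableEmbedding
      (fun p => inner ℂ (FourierTransform.fourier u ((2 * Real.pi)⁻¹ • p))
        (FourierTransform.fourier v ((2 * Real.pi)⁻¹ • p))),
    Measure.integral_comp_smul volume
      (fun p => inner ℂ (FourierTransform.fourier u p) (FourierTransform.fourier v p)),
    SchwartzMap.integral_inner_fourier_fourier, finrank_euclideanSpace_fin, Complex.real_smul,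
    inv_pow, inv_inv, abs_of_pos (by positivity)]
  push_cast
  congr 2
  funext ξ
  simp only [u, v, RCLike.inner_apply, windowed_apply, map_mul, Complex.conj_conj]
  ring

theorem integrable_inv_one_add_norm_pow_phase {m : ℕ} (hm : Module.finrank ℝ (Phase ℝ n) < m) :
    Integrable fun Y : Phase ℝ n => ((1 + ‖Y‖) ^ m)⁻¹ :=
  haveI : (volume : Measure (Phase ℝ n)).IsAddHaarMeasure :=
    Measure.prod.instIsAddHaarMeasure volume volume
  integrable_inv_one_add_norm_pow volume hm

theorem continuous_l2_weyl_left (g ψ : Wave n) :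
    Continuous fun Y : Phase ℝ n => l2 (weyl Y g) ψ := by
  simp only [← l2_conj ψ]
  exact Complex.continuous_conj.comp (continuous_l2_weyl ψ g)

theorem exists_norm_l2_weyl_left_le (m : ℕ) (g ψ : Wave n) :
    ∃ K, 0 ≤ K ∧ ∀ Y : Phase ℝ n, ‖l2 (weyl Y g) ψ‖ ≤ K * ((1 + ‖Y‖) ^ m)⁻¹ := by
  simp only [← l2_conj ψ, RCLike.norm_conj]
  exact exists_norm_l2_weyl_le m ψ g

theorem integrable_l2_weyl_left (g ψ : Wave n) :
    Integrable fun Y : Phase ℝ n => l2 (weyl Y g) ψ := by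
  obtain ⟨K, -, hK⟩ := exists_norm_l2_weyl_left_le (Module.finrank ℝ (Phase ℝ n) + 1) g ψ
  exact ((integrable_inv_one_add_norm_pow_phase (Nat.lt_succ_self _)).const_mul K).mono'
    (continuous_l2_weyl_left g ψ).aestronglyMeasurable (.of_forall hK)

theorem integrable_l2_weyl_mul (g φ ψ : Wave n) :
    Integrable fun Y : Phase ℝ n => l2 (weyl Y g) ψ * l2 φ (weyl Y g) := by
  obtain ⟨K, hK⟩ := norm_l2_weyl_le φ g
  exact (integrable_l2_weyl_left g ψ).mul_bdd (c := K)
    (continuous_l2_weyl φ g).aestronglyMeasurable (.of_forall hK)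

-- The Moyal identity: Plancherel in the momentum `P`, then translation invariance in `Q`.
theorem integral_l2_weyl_mul (g φ ψ : Wave n) :
    ∫ Y : Phase ℝ n, l2 (weyl Y g) ψ * l2 φ (weyl Y g)
      = (2 * Real.pi) ^ n * (l2 g g * l2 φ ψ) := by
  have hconv : ∫ q, ∫ ξ, (conj (φ ξ) * ψ ξ) * (g (ξ - q) * conj (g (ξ - q)))
      = l2 φ ψ * l2 g g := by
    have hc := integral_convolution (μ := volume) (ν := volume) (ContinuousLinearMap.mul ℝ ℂ)
      (l2_integrable φ ψ) (l2_integrable g g).comp_neg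
    simp only [convolution_def, ContinuousLinearMap.mul_apply', neg_sub] at hc
    rw [integral_neg_eq_self (fun ξ => conj (g ξ) * g ξ)] at hc
    simpa only [l2, mul_comm (g _)] using hc
  calc ∫ Y : Phase ℝ n, l2 (weyl Y g) ψ * l2 φ (weyl Y g)
      = ∫ Q : Fin n → ℝ, ∫ P : Fin n → ℝ, l2 (weyl (P, Q) g) ψ * l2 φ (weyl (P, Q) g) :=
        integral_prod_symm (μ := (volume : Measure (Fin n → ℝ)))
          (ν := (volume : Measure (Fin n → ℝ))) _ (integrable_l2_weyl_mul g φ ψ)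
    _ = (2 * Real.pi) ^ n *
          ∫ q, ∫ ξ, (conj (φ ξ) * ψ ξ) * (g (ξ - q) * conj (g (ξ - q))) := by
        simp only [integral_l2_weyl_mul_fst]
        rw [integral_const_mul, (PiLp.volume_preserving_toLp (Fin n)).integral_comp
          (MeasurableEquiv.toLp 2 (Fin n → ℝ)).measurableEmbedding
          (fun q => ∫ ξ, (conj (φ ξ) * ψ ξ) * (g (ξ - q) * conj (g (ξ - q))))]
    _ = (2 * Real.pi) ^ n * (l2 g g * l2 φ ψ) := by rw [hconv, mul_comm (l2 φ ψ)]

theorem l2_self_ne_zero {g : Wave n} (hg : g ≠ 0) : l2 g g ≠ 0 := by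
  have hinner : l2 g g = inner ℂ (g.toLp 2) (g.toLp 2) := by
    simp only [SchwartzMap.inner_toL2_toL2_eq, RCLike.inner_apply, l2, mul_comm]
  rw [hinner, inner_self_ne_zero]
  exact fun hzero => hg (SchwartzMap.injective_toLp 2 volume
    (hzero.trans (map_zero (SchwartzMap.toLpCLM ℂ ℂ 2 volume)).symm))

end Moyal

namespace ConstraintPlane

variable {n k : ℕ} (C : ConstraintPlane n k)

theorem exists_norm_cls_weyl_le (g : Wave n) : ∃ B, ∀ Y : Phase ℝ n, ‖C.cls (weyl Y g)‖ ≤ B := by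
  refine ⟨√(∫ X : C.plane, ‖l2 g (weyl (X : Phase ℝ n) g)‖ ∂C.μ), fun Y => Real.le_sqrt_of_sq_le ?_⟩
  rw [norm_cls_sq]
  refine (Complex.re_le_norm _).trans ((norm_integral_le_integral_norm _).trans_eq ?_)
  congr 1
  funext X
  rw [← l2_weyl_weyl (-Y), weyl_neg_weyl, norm_l2_weyl_weyl, norm_l2_weyl_weyl,
    neg_add_cancel_comm]

theorem integrable_l2_weyl_mul_l2_weyl_weyl (g φ ψ : Wave n) :
    Integrable (Function.uncurry fun (X : C.plane) (Y : Phase ℝ n) =>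
      l2 (weyl Y g) ψ * l2 φ (weyl (X : Phase ℝ n) (weyl Y g))) (C.μ.prod volume) := by
  set m := Module.finrank ℝ C.plane + 1
  set m' := Module.finrank ℝ (Phase ℝ n) + 1
  obtain ⟨K, -, hK⟩ := exists_norm_l2_weyl_weyl_le m φ g
  obtain ⟨K', hK'₀, hK'⟩ := exists_norm_l2_weyl_left_le (m + m') g ψ
  have hcont : Continuous fun p : C.plane × Phase ℝ n =>
      l2 (weyl p.2 g) ψ * l2 φ (weyl (p.1 : Phase ℝ n) (weyl p.2 g)) := by
    have hleft := (continuous_l2_weyl_left g ψ).comp (continuous_snd (X := C.plane))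
    have hright := (continuous_l2_weyl φ g).comp
      (f := fun p : C.plane × Phase ℝ n => (p.1 : Phase ℝ n) + p.2) (by fun_prop)
    simp only [weyl_weyl, l2_smul_right, sympl]
    exact hleft.mul (.mul (by fun_prop) hright)
  have hdom := (integrable_inv_one_add_norm_pow C.μ (m := m) (Nat.lt_succ_self _)).mul_prod
    (integrable_inv_one_add_norm_pow_phase (n := n) (m := m') (Nat.lt_succ_self _))
  refine (hdom.const_mul (K * K')).mono' hcont.aestronglyMeasurable (.of_forall fun ⟨X, Y⟩ => ?_)
  calc ‖l2 (weyl Y g) ψ * l2 φ (weyl (X : Phase ℝ n) (weyl Y g))‖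
      ≤ (K' * ((1 + ‖Y‖) ^ (m + m'))⁻¹) * (K * (1 + ‖Y‖) ^ m * ((1 + ‖X‖) ^ m)⁻¹) := by
        rw [norm_mul]
        gcongr
        exacts [hK' Y, hK X Y]
    _ = K * K' * (((1 + ‖X‖) ^ m)⁻¹ * ((1 + ‖Y‖) ^ m')⁻¹) := by
        have hne : (1 + ‖Y‖) ^ m ≠ 0 := by positivity
        rw [pow_add]
        field_simp

theorem integral_l2_weyl_mul_form (g φ ψ : Wave n) :
    ∫ Y : Phase ℝ n, l2 (weyl Y g) ψ * C.form φ (weyl Y g)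
      = (2 * Real.pi) ^ n * l2 g g * C.form φ ψ :=
  calc ∫ Y : Phase ℝ n, l2 (weyl Y g) ψ * C.form φ (weyl Y g)
      = ∫ X : C.plane, (∫ Y : Phase ℝ n,
          l2 (weyl Y g) ψ * l2 φ (weyl (X : Phase ℝ n) (weyl Y g))) ∂C.μ := by
        rw [integral_integral_swap (C.integrable_l2_weyl_mul_l2_weyl_weyl g φ ψ)]
        simp only [integral_const_mul, form]
    _ = ∫ X : C.plane, (2 * Real.pi) ^ n * l2 g g * l2 φ (weyl (X : Phase ℝ n) ψ) ∂C.μ := by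
        simp only [l2_weyl_right _ φ, integral_l2_weyl_mul, mul_assoc]
    _ = (2 * Real.pi) ^ n * l2 g g * C.form φ ψ := integral_const_mul _ _

@[elab_as_elim]
theorem induction_on_cls {p : C.PhysSpace → Prop} (v : C.PhysSpace) (hp : IsClosed {v | p v})
    (h : ∀ φ : Wave n, p (C.cls φ)) : p v :=
  UniformSpace.Completion.induction_on v hp fun u => by
    obtain ⟨φ, rfl⟩ := C.surjective_cls u
    exact h φ

theorem exists_mul_norm_inner_cls_le (g ψ : Wave n) :
    ∃ M, ∀ v w : C.PhysSpace, (∀ Y, inner ℂ v (C.cls (weyl Y g) : C.PhysSpace) = 0) →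
      ‖(2 * Real.pi : ℂ) ^ n * l2 g g‖ * ‖inner ℂ w (C.cls ψ : C.PhysSpace)‖ ≤ ‖w - v‖ * M := by
  obtain ⟨B, hB⟩ := C.exists_norm_cls_weyl_le g
  refine ⟨B * ∫ Y : Phase ℝ n, ‖l2 (weyl Y g) ψ‖, fun v w hv => ?_⟩
  refine C.induction_on_cls w ?_ fun φ => ?_
  · exact isClosed_le (by fun_prop) (by fun_prop)
  rw [UniformSpace.Completion.inner_coe, inner_cls, ← norm_mul, ← integral_l2_weyl_mul_form,
    ← mul_assoc, ← integral_const_mul]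
  refine norm_integral_le_of_norm_le ((integrable_l2_weyl_left g ψ).norm.const_mul _)
    (.of_forall fun Y => ?_)
  have hinner : C.form φ (weyl Y g)
      = inner ℂ ((C.cls φ : C.PhysSpace) - v) (C.cls (weyl Y g) : C.PhysSpace) := by
    rw [inner_sub_left, hv, sub_zero, UniformSpace.Completion.inner_coe, inner_cls]
  rw [norm_mul, mul_comm, hinner]
  gcongr
  refine (norm_inner_le_norm (𝕜 := ℂ) ((C.cls φ : C.PhysSpace) - v) _).trans ?_
  gcongr
  rw [UniformSpace.Completion.norm_coe]
  exact hB Y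

theorem dense_span_cls_weyl {g : Wave n} (hg : g ≠ 0) :
    Dense (Submodule.span ℂ
      (Set.range fun Y : Phase ℝ n => (C.cls (weyl Y g) : C.PhysSpace)) : Set C.PhysSpace) := by
  rw [Submodule.dense_iff_topologicalClosure_eq_top, Submodule.topologicalClosure_eq_top_iff,
    Submodule.eq_bot_iff]
  intro v hv
  have hv_weyl (Y : Phase ℝ n) : inner ℂ v (C.cls (weyl Y g) : C.PhysSpace) = 0 :=
    Submodule.inner_left_of_mem_orthogonal (Submodule.subset_span (Set.mem_range_self Y)) hv
  have hN : (2 * Real.pi : ℂ) ^ n * l2 g g ≠ 0 :=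
    mul_ne_zero (pow_ne_zero _ (by exact_mod_cast Real.two_pi_pos.ne')) (l2_self_ne_zero hg)
  have hv_cls (ψ : Wave n) : inner ℂ v (C.cls ψ : C.PhysSpace) = 0 := by
    obtain ⟨M, hM⟩ := C.exists_mul_norm_inner_cls_le g ψ
    have hle := hM v v hv_weyl
    rw [sub_self, norm_zero, zero_mul] at hle
    exact norm_le_zero_iff.1 (nonpos_of_mul_nonpos_right hle (norm_pos_iff.2 hN))
  have hv_all (w : C.PhysSpace) : inner ℂ v w = 0 :=
    C.induction_on_cls w (isClosed_eq (by fun_prop) continuous_const) hv_cls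
  exact inner_self_eq_zero.1 (hv_all v)

end ConstraintPlane

namespace ConstraintPlane

variable {n k : ℕ} (C : ConstraintPlane n k) {c : ℂ} {A : Matrix (Fin n) (Fin n) ℂ} {ψ : Wave n}

-- `ω(J ·, ·)` is definite on the plane, so `ω(Y, ·)` is represented there by some `ω(J X, ·)`.
theorem exists_sub_complexStructure_mem_skewPerp (hA : A.IsSymm)
    (hpos : (A.map Complex.im).PosDef) (Y : Phase ℝ n) :
    ∃ X ∈ C.plane, Y - complexStructure A X ∈ C.skewPerp := by
  have hdef (X : Phase ℝ n) (_ : X ∈ C.plane)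
      (hzero : (symplBilin ℝ n ∘ₗ complexStructure A) X X = 0) : X = 0 := by
    by_contra hne
    exact (sympl_complexStructure_self_pos hA hpos hne).ne' hzero
  obtain ⟨X, hX, hrep⟩ := exists_mem_forall_apply_eq _ C.plane hdef (symplBilin ℝ n Y)
  refine ⟨X, hX, fun X' hX' => ?_⟩
  rw [sympl_sub_left, sub_eq_zero]
  exact (hrep X' hX').symm

-- `Ω(X)` vanishes on classes, which turns `s ↦ e^{iΩ(sV)} χ` into a scalar linear flow.
theorem cls_weyl_of_Omega_eq {X V : Phase ℝ n} (hX : X ∈ C.plane) {χ : Wave n} {κ : ℂ}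
    (hV : Omega (toComplex V) χ = Complex.I • Omega (toComplex X) χ + κ • χ) :
    C.cls (weyl V χ)
      = Complex.exp ((sympl X V : ℝ) / 2 + Complex.I * κ) • C.cls χ := by
  rw [← cls_smul]
  refine C.cls_eq_of_form fun φ => ?_
  have hderiv (s : ℝ) : HasDerivAt (fun t : ℝ => C.form φ (weyl (t • V) χ))
      ((s * (sympl X V : ℝ) + Complex.I * κ) * C.form φ (weyl (s • V) χ)) s := by
    refine (C.hasDerivAt_form_weyl φ χ V s).congr_deriv ?_
    have hconstraint := C.form_Omega_of_mem hX φ (weyl (s • V) χ)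
    rw [Omega_weyl, sympl_toComplex, sympl_smul_right, form_add_right, form_smul_right]
      at hconstraint
    rw [hV, map_add, map_smul, map_smul, form_add_right, form_smul_right, form_smul_right]
    push_cast at hconstraint
    linear_combination (-1 : ℂ) * hconstraint +
      C.form φ (weyl (s • V) (Omega (toComplex X) χ)) * Complex.I_mul_I
  have hflow := eq_exp_mul_of_hasDerivAt hderiv 1
  simpa only [one_smul, zero_smul, weyl_zero, Complex.ofReal_one, one_pow, one_mul,
    form_smul_right] using hflow

theorem exists_cls_weyl_complexStructure_eq_smul (h : IsGaussian c A ψ) {X Y : Phase ℝ n}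
    (hX : X ∈ C.plane) (hY : Y ∈ C.skewPerp) :
    ∃ κ : ℂ, C.cls (weyl (complexStructure A X) (weyl Y ψ)) = κ • C.cls (weyl Y ψ) := by
  refine ⟨_, C.cls_weyl_of_Omega_eq hX (κ := (sympl (complexStructure A X) Y : ℝ)) ?_⟩
  have hXY : sympl X Y = 0 := by rw [sympl_comm, hY X hX, neg_zero]
  rw [Omega_weyl, h.Omega_complexStructure, Omega_weyl, sympl_toComplex, sympl_toComplex, hXY,
    map_smul, Complex.ofReal_zero, zero_smul, add_zero]

theorem exists_skewPerp_cls_weyl_eq_smul (h : IsGaussian c A ψ) (Y : Phase ℝ n) :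
    ∃ Z ∈ C.skewPerp, ∃ κ : ℂ, C.cls (weyl Y ψ) = κ • C.cls (weyl Z ψ) := by
  obtain ⟨X, hX, hZ⟩ := C.exists_sub_complexStructure_mem_skewPerp h.2.1 h.2.2.1 Y
  obtain ⟨κ, hκ⟩ := C.exists_cls_weyl_complexStructure_eq_smul h hX hZ
  rw [weyl_weyl, add_sub_cancel, cls_smul, ← eq_inv_smul_iff₀ (Complex.exp_ne_zero _), smul_smul]
    at hκ
  exact ⟨_, hZ, _, hκ⟩

theorem dense_span_weyl (h : IsGaussian c A ψ) :
    Dense (Submodule.span ℂ {v : C.PhysSpace | ∃ Y : C.skewPerp,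
      v = C.weylPhys Y (C.cls ψ : C.PhysSpace)} : Set C.PhysSpace) := by
  refine (C.dense_span_cls_weyl h.ne_zero).mono (Submodule.span_le.2 ?_)
  rintro _ ⟨Y, rfl⟩
  obtain ⟨Z, hZ, κ, hκ⟩ := C.exists_skewPerp_cls_weyl_eq_smul h Y
  simp only [hκ, UniformSpace.Completion.coe_smul]
  refine Submodule.smul_mem _ _ (Submodule.subset_span ⟨⟨Z, hZ⟩, ?_⟩)
  rw [weylPhys_cls]

end ConstraintPlane

namespace ConstraintPlane

variable {n k : ℕ} (C : ConstraintPlane n k) {c : ℂ} {A : Matrix (Fin n) (Fin n) ℂ} {ψ : Wave n}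

theorem smul_mem_skewPerp {Y : Phase ℝ n} (hY : Y ∈ C.skewPerp) (s : ℝ) : s • Y ∈ C.skewPerp :=
  fun X hX => by rw [sympl_smul_left, hY X hX, mul_zero]

theorem sub_mem_skewPerp {Y X : Phase ℝ n} (hY : Y ∈ C.skewPerp) (hX : X ∈ C.plane) :
    Y - X ∈ C.skewPerp :=
  fun X' hX' => by rw [sympl_sub_left, hY X' hX', C.isotropic X hX X' hX', sub_zero]

theorem mem_skewPerpC_iff {Z : Phase ℂ n} :
    Z ∈ C.skewPerpC ↔ ∀ X ∈ C.plane, sympl Z (toComplex X) = 0 := by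
  change C.planeC ≤ (symplBilin ℂ n Z).ker ↔ _
  rw [planeC, Submodule.span_le, Set.image_subset_iff]
  rfl

theorem toComplex_mem_skewPerpC {Y : Phase ℝ n} (hY : Y ∈ C.skewPerp) :
    toComplex Y ∈ C.skewPerpC :=
  C.mem_skewPerpC_iff.2 fun X hX => by rw [sympl_toComplex, hY X hX, Complex.ofReal_zero]

theorem cls_weyl_sub {Y X : Phase ℝ n} (hY : Y ∈ C.skewPerp) (hX : X ∈ C.plane) (ψ : Wave n) :
    C.cls (weyl (Y - X) ψ) = C.cls (weyl Y ψ) := by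
  refine C.cls_eq_of_form fun φ => ?_
  rw [← C.form_weyl_of_mem hX φ (weyl (Y - X) ψ), weyl_weyl, sympl_comm,
    C.sub_mem_skewPerp hY hX X hX, neg_zero, Complex.ofReal_zero, mul_zero, Complex.exp_zero,
    one_smul, add_sub_cancel]

theorem weylQuot_cls (Y : C.skewPerp) (ψ : Wave n) :
    C.weylQuot Y (C.cls ψ) = C.cls (weyl (Y : Phase ℝ n) ψ) := rfl

theorem mem_germ_iff {Z : Phase ℂ n} : Z ∈ C.germ ψ ↔ Z ∈ C.skewPerpC ∧ C.cls (Omega Z ψ) = 0 := by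
  simp only [germ, Set.mem_ofPred_eq, omegaQuot_cls, norm_eq_zero, exists_prop]

theorem exists_mem_germ_toComplex_eq_add_star (h : IsGaussian c A ψ) {Y : Phase ℝ n}
    (hY : Y ∈ C.skewPerp) (hJY : complexStructure A Y ∈ C.skewPerp) :
    ∃ Z ∈ C.germ ψ, toComplex Y = Z + star Z := by
  refine ⟨(1 / 2 : ℂ) • (toComplex Y + Complex.I • toComplex (complexStructure A Y)),
    C.mem_germ_iff.2 ⟨C.mem_skewPerpC_iff.2 fun X hX => ?_, ?_⟩, ?_⟩
  · rw [sympl_smul_left, sympl_add_left, sympl_smul_left, sympl_toComplex, sympl_toComplex,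
      hY X hX, hJY X hX, Complex.ofReal_zero, mul_zero, add_zero, mul_zero]
  · rw [Omega_smul, Omega_add, Omega_smul, _root_.smul_apply, _root_.add_apply, _root_.smul_apply,
      h.Omega_complexStructure, smul_smul, Complex.I_mul_I, neg_one_smul, add_neg_cancel, smul_zero]
    rfl
  · rw [star_smul, star_add, star_smul, star_toComplex, star_toComplex]
    simp only [one_div, star_inv₀, RCLike.star_def, Complex.conj_I, Complex.conj_ofNat]
    module

theorem hasDerivAt_inner_weylQuot {Y : Phase ℝ n} (hY : Y ∈ C.skewPerp) (u w : C.Quot)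
    (t : ℝ) :
    HasDerivAt (fun s : ℝ => inner ℂ u (C.weylQuot ⟨s • Y, C.smul_mem_skewPerp hY s⟩ w))
      (Complex.I * inner ℂ u (C.weylQuot ⟨t • Y, C.smul_mem_skewPerp hY t⟩
        (C.omegaQuot ⟨toComplex Y, C.toComplex_mem_skewPerpC hY⟩ w))) t := by
  obtain ⟨φ, rfl⟩ := C.surjective_cls u
  obtain ⟨χ, rfl⟩ := C.surjective_cls w
  exact C.hasDerivAt_form_weyl φ χ Y t

theorem inner_omegaQuot_left {Z : Phase ℂ n} (hZ : Z ∈ C.skewPerpC) (u w : C.Quot) :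
    inner ℂ (C.omegaQuot ⟨Z, hZ⟩ u) w
      = inner ℂ u (C.omegaQuot ⟨star Z, C.star_mem_skewPerpC hZ⟩ w) := by
  obtain ⟨φ, rfl⟩ := C.surjective_cls u
  obtain ⟨χ, rfl⟩ := C.surjective_cls w
  have hform := (C.form_Omega (C.star_mem_skewPerpC hZ) φ χ).symm
  rw [star_star] at hform
  exact hform

theorem omegaQuot_mul_comm (Z W : C.skewPerpC) :
    C.omegaQuot Z * C.omegaQuot W = C.omegaQuot W * C.omegaQuot Z
      + (-Complex.I * sympl (Z : Phase ℂ n) W) • 1 := by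
  refine LinearMap.ext fun u => ?_
  obtain ⟨φ, rfl⟩ := C.surjective_cls u
  rw [LinearMap.add_apply, LinearMap.smul_apply, Module.End.mul_apply, Module.End.mul_apply,
    Module.End.one_apply, omegaQuot_cls, omegaQuot_cls, omegaQuot_cls, omegaQuot_cls, Omega_comm,
    cls_add, cls_smul]

theorem omegaQuot_eq_add {Y Z W : C.skewPerpC} (h : (Y : Phase ℂ n) = Z + W) :
    C.omegaQuot Y = C.omegaQuot Z + C.omegaQuot W := by
  refine LinearMap.ext fun u => ?_
  obtain ⟨φ, rfl⟩ := C.surjective_cls u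
  rw [LinearMap.add_apply, omegaQuot_cls, omegaQuot_cls, omegaQuot_cls, h, Omega_add,
    _root_.add_apply, cls_add]

theorem cls_weyl_mem_closure_span_creation {Y : Phase ℝ n} (hY : Y ∈ C.skewPerp) {Z : Phase ℂ n}
    (hZ : Z ∈ C.germ ψ) (hYZ : toComplex Y = Z + star Z) :
    C.cls (weyl Y ψ) ∈ closure (Submodule.span ℂ
      (Set.range fun p : ℕ => (C.creation ψ ⟨star Z, Z, hZ, rfl⟩ ^ p) (C.cls ψ)) : Set C.Quot) := by
  obtain ⟨hZ', hZψ⟩ := C.mem_germ_iff.1 hZ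
  have hsum : C.omegaQuot ⟨toComplex Y, C.toComplex_mem_skewPerpC hY⟩
      = C.omegaQuot ⟨Z, hZ'⟩ + C.creation ψ ⟨star Z, Z, hZ, rfl⟩ := C.omegaQuot_eq_add hYZ
  have key := flow_mem_closure_span_pow (a := C.omegaQuot ⟨Z, hZ'⟩)
    (b := C.creation ψ ⟨star Z, Z, hZ, rfl⟩) (v := C.cls ψ)
    (U := fun s => C.weylQuot ⟨s • Y, C.smul_mem_skewPerp hY s⟩)
    (C.inner_omegaQuot_left hZ') (C.omegaQuot_mul_comm _ _) hZψ
    (fun w => ?_) (fun t w => (LinearIsometry.norm_map _ w).le)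
    (fun u w t => by rw [← hsum]; exact C.hasDerivAt_inner_weylQuot hY u w t)
  · simpa only [weylQuot_cls, one_smul] using key
  · obtain ⟨φ, rfl⟩ := C.surjective_cls w
    simp only [weylQuot_cls, zero_smul, weyl_zero]

theorem coe_mem_closure_span_creation {Z : Phase ℂ n} (hZ : Z ∈ C.conjGerm ψ) {v : C.Quot}
    (hv : v ∈ closure (Submodule.span ℂ
      (Set.range fun p : ℕ => (C.creation ψ ⟨Z, hZ⟩ ^ p) (C.cls ψ)) : Set C.Quot)) :
    (v : C.PhysSpace) ∈ closure (Submodule.span ℂ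
      {u : C.PhysSpace | ∃ (p : ℕ) (Z : Fin p → C.conjGerm ψ),
        u = ((List.ofFn fun j => C.creation ψ (Z j)).prod (C.cls ψ) : C.Quot)} :
        Set C.PhysSpace) := by
  refine map_mem_closure (UniformSpace.Completion.continuous_coe C.Quot) hv fun w hw => ?_
  have hw' := Submodule.mem_map_of_mem
    (f := (UniformSpace.Completion.toComplₗᵢ (𝕜 := ℂ) (E := C.Quot)).toLinearMap) hw
  rw [Submodule.map_span] at hw'
  refine Submodule.span_le.2 ?_ hw'
  rintro _ ⟨_, ⟨p, rfl⟩, rfl⟩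
  refine Submodule.subset_span ⟨p, fun _ => ⟨Z, hZ⟩, ?_⟩
  rw [List.ofFn_const, List.prod_replicate]
  rfl

theorem dense_span_creation (h : IsGaussian c A ψ) :
    Dense (Submodule.span ℂ {v : C.PhysSpace | ∃ (p : ℕ) (Z : Fin p → C.conjGerm ψ),
      v = ((List.ofFn fun j => C.creation ψ (Z j)).prod (C.cls ψ) : C.Quot)} :
        Set C.PhysSpace) := by
  refine dense_closure.1 ((C.dense_span_weyl h).mono ?_)
  rw [← Submodule.topologicalClosure_coe]
  refine Submodule.span_le.2 ?_
  rintro _ ⟨⟨Y, hY⟩, rfl⟩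
  obtain ⟨X, hX, hJ⟩ := C.exists_sub_complexStructure_mem_skewPerp h.2.1 h.2.2.1
    (complexStructure A Y)
  rw [← map_sub] at hJ
  have hYX := C.sub_mem_skewPerp hY hX
  obtain ⟨Z, hZ, hYZ⟩ := C.exists_mem_germ_toComplex_eq_add_star h hYX hJ
  rw [weylPhys_cls, ← C.cls_weyl_sub hY hX]
  exact C.coe_mem_closure_span_creation _ (C.cls_weyl_mem_closure_span_creation hYX hZ hYZ)

end ConstraintPlane

end LinearConstraint

theorem lemma15 {n k : ℕ} (C : LinearConstraint.ConstraintPlane n k) (c : ℂ)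
    (A : Matrix (Fin n) (Fin n) ℂ) (ψA : LinearConstraint.Wave n)
    (hψA : LinearConstraint.IsGaussian c A ψA) :
    Dense (Submodule.span ℂ {v : C.PhysSpace | ∃ Y : C.skewPerp,
      v = C.weylPhys Y (C.cls ψA : C.PhysSpace)} : Set C.PhysSpace) ∧
    Dense (Submodule.span ℂ {v : C.PhysSpace | ∃ (p : ℕ) (Z : Fin p → C.conjGerm ψA),
      v = ((List.ofFn fun j => C.creation ψA (Z j)).prod (C.cls ψA) : C.Quot)} :
        Set C.PhysSpace) :=
  ⟨C.dense_span_weyl hψA, C.dense_span_creation hψA⟩
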